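/- **Setting.** Let $F_Z$ be an error distribution with density $f_Z$ on $\mathbb R$ that is strictly positive, log-concave and twice continuously differentiable with bounded first and second derivatives. Let $\Theta\subset\mathbb R^v$ be compact, let $\Xi\subseteq\mathbb R$ be an open interval (the sample space), and let $a:\Xi\to\mathbb R^{d}$ be a differentiable basis. For $\theta\in\Theta$ and a feature value $x$ let $\vartheta_\theta(x)\in\mathbb R^d$ (basis coefficients), $\phi_\theta\in\mathbb R^p$ (autoregressive coefficients) and $r_\theta(x)\in\mathbb R$ (remainder) be measurable in $x$, continuous in $\theta$ on $\Theta$ and twice continuously differentiable in $\theta$ on the interior of $\Theta$. The AT($p$) transformation is $$h_t(y;\theta)=h_{1}(y\mid x_t)+\sum_{j=1}^p\phi_{\theta,j}\,h_{1}(Y_{t-j}\mid x_t)+r_\theta(x_t),\qquad h_{1}(y\mid x)=a(y)^\top\vartheta_\theta(x),$$ where $\partial h_t(y;\theta)/\partial y>0$ for all $y\in\Xi$, $\theta\in\Theta$ and all feature values. The observations are $Y_1,Y_2,\dots\in\Xi$ with (possibly time-varying) features $x_1,x_2,\dots$, and $\mathcal Y_0=(Y_0,\dots,Y_{1-p})$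 are finite starting values in $\Xi$ (fixed or random). $(\mathcal F_t)_{t\ge0}$ is a filtration such that $\mathcal Y_0$ is $\mathcal F_0$-measurable, $Y_t$ is $\mathcal F_t$-measurable and $x_t$ is $\mathcal F_{t-1}$-measurable for $t\ge1$. Call $\theta$ a true value if $\mathbb P(Y_t\le y\mid\mathcal F_{t-1})=F_Z(h_t(y;\theta))$ a.s. for all $t>p$, $y\in\Xi$. Let $\theta^*\in\operatorname{int}\Theta$ be a true value. Put $$\ell_t(\theta)=\log f_Z(h_t(Y_t;\theta))+\log\Bigl|\tfrac{\partial h_t(y;\theta)}{\partial y}\Big|_{y=Y_t}\Bigr|,\quad \nabla_t(\theta)=\frac{\partial\ell_t(\theta)}{\partial\theta},\quad \mathcal J_t(\theta)=-\frac{\partial^2\ell_t(\theta)}{\partial\theta\,\partial\theta^\top},$$ $\mathcal I=\mathbb E[\mathcal J_t(\theta^*)]$ and $\mathfrak J=\mathbb E[\nabla_t(\theta^*)\nabla_t(\theta^*)^\top]$ (for $t>p$; by stationarity they do not depend on $t$), and let $\hat\theta_T\in\arg\min_{\theta\in\Theta}\bigl(-\sum_{t=1}^T\ell_t(\theta)\bigr)$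 be a maximum likelihood estimator. **Assumptions** (the moment conditions are for $t>p$). (i) $(Y_t,x_t)_{t\ge1}$ is strictly stationary and ergodic (for constant features: $(Y_t)_{t\ge1}$ is). (ii) $\mathbb E\{\sup_{\theta\in\Theta}\ell_t(\theta)\}<\infty$, in the sense that the positive part of the supremum has finite expectation; $\mathbb E|\ell_t(\theta^*)|<\infty$; and $\theta^*$ is the only true value in $\Theta$. (iii) $\nabla_t(\theta^*)$ is a martingale difference with respect to $(\mathcal F_t)$ with finite second moments, and $\mathfrak J$ is positive definite. (iv) $\mathcal I$ is positive definite, and $\mathbb E\{\sup_{\|\theta-\theta^*\|<\xi}\|\mathcal J_t(\theta)\|\}<\infty$ for some $\xi>0$. **Theorem.** Under these assumptions, as $T\to\infty$, $$\hat{\mathcal I}_T=\frac1T\sum_{t=1}^T\mathcal J_t(\hat\theta_T)\qquad\text{and}\qquad\hat{\mathfrak J}_T=\frac1T\sum_{t=1}^T\nabla_t(\hat\theta_T)\nabla_t(\hat\theta_T)^\top$$ are consistent estimators of $\mathcal I$ and $\mathfrak J$, respectively, that is, they converge to $\mathcal I$ and $\mathfrak J$ in probability. -/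

import Mathlib

open MeasureTheory ProbabilityTheory Filter

namespace ATM

noncomputable section

/-- The ambient space of the model parameters. -/
abbrev Param (v : ℕ) : Type := EuclideanSpace ℝ (Fin v)

/-- An error distribution, given by its Lebesgue density: a strictly positive, log-concave, twice
continuously differentiable probability density with bounded first and second derivatives. -/
structure ErrorDist where
  /-- the density `f_Z` -/
  pdf : ℝ → ℝ
  pdf_pos : ∀ z, 0 < pdf z
  integrable_pdf : Integrable pdf
  integral_pdf : ∫ z, pdf z = 1
  logConcave : ConcaveOn ℝ Set.univ (fun z => Real.log (pdf z))
  contDiff_pdf : ContDiff ℝ 2 pdf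
  bounded_deriv : ∃ C, ∀ z, |deriv pdf z| ≤ C
  bounded_deriv_two : ∃ C, ∀ z, |deriv (deriv pdf) z| ≤ C

/-- The distribution function `F_Z`. -/
def ErrorDist.cdf (Z : ErrorDist) (z : ℝ) : ℝ := ∫ u in Set.Iic z, Z.pdf u

/-- An autoregressive transformation model of order `p` with `v` real parameters, `d` basis
functions and features in `𝒳`: the basis `a`, the basis coefficients `ϑ_θ(x)`, the autoregressive
coefficients `φ_θ` and the remainder term `r_θ(x)`, all parameterized by `θ`. -/
structure ATModel (v p d : ℕ) (𝒳 : Type*) [MeasurableSpace 𝒳] where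
  /-- the compact parameter space -/
  Θ : Set (Param v)
  isCompact_Θ : IsCompact Θ
  /-- the sample space of a single observation, an open interval (possibly the whole line) -/
  Ξ : Set ℝ
  isOpen_Ξ : IsOpen Ξ
  ordConnected_Ξ : Ξ.OrdConnected
  /-- the basis functions -/
  a : ℝ → Fin d → ℝ
  differentiableAt_a : ∀ y ∈ Ξ, DifferentiableAt ℝ a y
  /-- the basis coefficients -/
  ϑ : Param v → 𝒳 → Fin d → ℝ
  /-- the autoregressive coefficients; the component `j : Fin p` belongs to lag `j + 1` -/
  φ : Param v → Fin p → ℝ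
  /-- the remainder term -/
  r : Param v → 𝒳 → ℝ
  measurable_ϑ : ∀ θ ∈ Θ, Measurable (ϑ θ)
  measurable_r : ∀ θ ∈ Θ, Measurable (r θ)
  continuousOn_ϑ : ∀ x, ContinuousOn (fun θ => ϑ θ x) Θ
  continuousOn_φ : ContinuousOn φ Θ
  continuousOn_r : ∀ x, ContinuousOn (fun θ => r θ x) Θ
  contDiffOn_ϑ : ∀ x, ContDiffOn ℝ 2 (fun θ => ϑ θ x) (interior Θ)
  contDiffOn_φ : ContDiffOn ℝ 2 φ (interior Θ)
  contDiffOn_r : ∀ x, ContDiffOn ℝ 2 (fun θ => r θ x) (interior Θ)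
  /-- the transformation is increasing in the outcome, with positive derivative -/
  deriv_pos : ∀ θ ∈ Θ, ∀ x, ∀ y ∈ Ξ, 0 < deriv (fun u => ∑ m, a u m * ϑ θ x m) y

variable {v p d : ℕ} {𝒳 : Type*} [MeasurableSpace 𝒳]

/-- `h₁(y | x) = a(y)ᵀ ϑ(x)`. -/
def ATModel.h₁ (M : ATModel v p d 𝒳) (θ : Param v) (x : 𝒳) (y : ℝ) : ℝ :=
  ∑ m, M.a y m * M.ϑ θ x m

/-- `h₂ = ∑ⱼ φⱼ h₁(lag j | x) + r(x)`. -/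
def ATModel.h₂ (M : ATModel v p d 𝒳) (θ : Param v) (x : 𝒳) (lags : Fin p → ℝ) : ℝ :=
  ∑ j, M.φ θ j * M.h₁ θ x (lags j) + M.r θ x

/-- The transformation `h = h₁ + h₂`. -/
def ATModel.h (M : ATModel v p d 𝒳) (θ : Param v) (x : 𝒳) (lags : Fin p → ℝ) (y : ℝ) : ℝ :=
  M.h₁ θ x y + M.h₂ θ x lags

variable {Ω : Type*}

/-- The vector of the lags `(Y_{t-1}, …, Y_{t-p})`. The series is indexed by `ℤ`: the times `t ≥ 1`
are the observations, the times `1 - p ≤ t ≤ 0` the starting values; other times are not used. -/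
def lags (p : ℕ) (Y : ℤ → Ω → ℝ) (t : ℕ) (ω : Ω) (j : Fin p) : ℝ :=
  Y ((t : ℤ) - ((j : ℤ) + 1)) ω

/-- The log-likelihood contribution `ℓ_t(θ)` of the `t`-th observation. -/
def ell (Z : ErrorDist) (M : ATModel v p d 𝒳) (Y : ℤ → Ω → ℝ) (X : ℕ → Ω → 𝒳)
    (t : ℕ) (θ : Param v) (ω : Ω) : ℝ :=
  Real.log (Z.pdf (M.h θ (X t ω) (lags p Y t ω) (Y t ω))) +
    Real.log |deriv (fun y => M.h θ (X t ω) (lags p Y t ω) y) (Y t ω)|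

/-- The log-likelihood `ℓ(θ)` of the first `T` observations, given the starting values. -/
def logLik (Z : ErrorDist) (M : ATModel v p d 𝒳) (Y : ℤ → Ω → ℝ) (X : ℕ → Ω → 𝒳)
    (T : ℕ) (θ : Param v) (ω : Ω) : ℝ :=
  ∑ t ∈ Finset.Icc 1 T, ell Z M Y X t θ ω

/-- The `i`-th standard basis vector of the parameter space. -/
def basisVec (i : Fin v) : Param v := EuclideanSpace.single i (1 : ℝ)

/-- The score `∇_t(θ) = ∂ℓ_t(θ)/∂θ`. -/
def score (Z : ErrorDist) (M : ATModel v p d 𝒳) (Y : ℤ → Ω → ℝ) (X : ℕ → Ω → 𝒳)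
    (t : ℕ) (θ : Param v) (ω : Ω) : Fin v → ℝ :=
  fun i => fderiv ℝ (fun η => ell Z M Y X t η ω) θ (basisVec i)

/-- The observed Hessian `𝒥_t(θ) = -∂²ℓ_t(θ)/∂θ∂θᵀ`. -/
def hess (Z : ErrorDist) (M : ATModel v p d 𝒳) (Y : ℤ → Ω → ℝ) (X : ℕ → Ω → 𝒳)
    (t : ℕ) (θ : Param v) (ω : Ω) : Matrix (Fin v) (Fin v) ℝ :=
  Matrix.of fun i j =>
    -(fderiv ℝ (fun ζ => fderiv ℝ (fun η => ell Z M Y X t η ω) ζ (basisVec j)) θ (basisVec i))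

/-- The outer product `∇_t(θ) ∇_t(θ)ᵀ`. -/
def outer (Z : ErrorDist) (M : ATModel v p d 𝒳) (Y : ℤ → Ω → ℝ) (X : ℕ → Ω → 𝒳)
    (t : ℕ) (θ : Param v) (ω : Ω) : Matrix (Fin v) (Fin v) ℝ :=
  Matrix.vecMulVec (score Z M Y X t θ ω) (score Z M Y X t θ ω)

/-- `Î_T = (1/T) ∑ 𝒥_t(θ̂_T)`. -/
def hessEst (Z : ErrorDist) (M : ATModel v p d 𝒳) (Y : ℤ → Ω → ℝ) (X : ℕ → Ω → 𝒳)
    (θhat : ℕ → Ω → Param v) (T : ℕ) (ω : Ω) : Matrix (Fin v) (Fin v) ℝ :=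
  (1 / (T : ℝ)) • ∑ t ∈ Finset.Icc 1 T, hess Z M Y X t (θhat T ω) ω

/-- `𝔍̂_T = (1/T) ∑ ∇_t(θ̂_T) ∇_t(θ̂_T)ᵀ`. -/
def outerEst (Z : ErrorDist) (M : ATModel v p d 𝒳) (Y : ℤ → Ω → ℝ) (X : ℕ → Ω → 𝒳)
    (θhat : ℕ → Ω → Param v) (T : ℕ) (ω : Ω) : Matrix (Fin v) (Fin v) ℝ :=
  (1 / (T : ℝ)) • ∑ t ∈ Finset.Icc 1 T, outer Z M Y X t (θhat T ω) ω

variable [mΩ : MeasurableSpace Ω]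

/-- `I = E 𝒥_t(θ)`, at the first time whose lags are all observations; under stationarity every
later time gives the same matrix. -/
def infoMatrix (μ : Measure Ω) (Z : ErrorDist) (M : ATModel v p d 𝒳) (Y : ℤ → Ω → ℝ)
    (X : ℕ → Ω → 𝒳) (θ : Param v) : Matrix (Fin v) (Fin v) ℝ :=
  Matrix.of fun i j => ∫ ω, hess Z M Y X (p + 1) θ ω i j ∂μ

/-- `𝔍 = E ∇_t(θ) ∇_t(θ)ᵀ`, at the first time whose lags are all observations. -/
def outerMatrix (μ : Measure Ω) (Z : ErrorDist) (M : ATModel v p d 𝒳) (Y : ℤ → Ω → ℝ)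
    (X : ℕ → Ω → 𝒳) (θ : Param v) : Matrix (Fin v) (Fin v) ℝ :=
  Matrix.of fun i j => ∫ ω, outer Z M Y X (p + 1) θ ω i j ∂μ

/-- The data: starting values and observations are real numbers of the sample space, known at
time `0` and at their own time respectively; the features of time `t` are known at `t - 1`. -/
structure IsData (M : ATModel v p d 𝒳) (ℱ : Filtration ℕ mΩ) (Y : ℤ → Ω → ℝ)
    (X : ℕ → Ω → 𝒳) : Prop where
  mem_Ξ : ∀ t : ℤ, 1 - (p : ℤ) ≤ t → ∀ ω, Y t ω ∈ M.Ξ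
  measurable_Y : ∀ t : ℤ, 1 - (p : ℤ) ≤ t → Measurable[ℱ t.toNat] (Y t)
  measurable_X : ∀ t : ℕ, 1 ≤ t → Measurable[ℱ (t - 1)] (X t)

/-- `θ` is a true parameter value: for every time `t > p` the conditional distribution function of
`Y_t` given the past and the features is `F_Z(h_t(· ; θ))`. -/
def IsTrueParam (μ : Measure Ω) (Z : ErrorDist) (M : ATModel v p d 𝒳) (ℱ : Filtration ℕ mΩ)
    (Y : ℤ → Ω → ℝ) (X : ℕ → Ω → 𝒳) (θ : Param v) : Prop :=
  ∀ t : ℕ, p < t → ∀ y ∈ M.Ξ,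
    μ[(Y t ⁻¹' Set.Iic y).indicator (fun _ => (1 : ℝ)) | ℱ (t - 1)]
      =ᵐ[μ] fun ω => Z.cdf (M.h θ (X t ω) (lags p Y t ω) y)

/-- The path `(Y_t, X_t)`, `t = 1, 2, …`. -/
def path (Y : ℤ → Ω → ℝ) (X : ℕ → Ω → 𝒳) (ω : Ω) : ℕ → ℝ × 𝒳 :=
  fun k => (Y ((k : ℤ) + 1) ω, X (k + 1) ω)

/-- The series `(Y_t, X_t)`, `t ≥ 1`, is strictly stationary and ergodic: its law is invariant and
ergodic for the shift. -/
def IsStationaryErgodic (μ : Measure Ω) (Y : ℤ → Ω → ℝ) (X : ℕ → Ω → 𝒳) : Prop :=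
  Ergodic (fun (s : ℕ → ℝ × 𝒳) k => s (k + 1)) (μ.map (path Y X))

attribute [local instance] Matrix.frobeniusSeminormedAddCommGroup

/-- The conditions on the series, the log-likelihood contributions and the true value `θstar`. -/
structure Conditions (μ : Measure Ω) (Z : ErrorDist) (M : ATModel v p d 𝒳)
    (ℱ : Filtration ℕ mΩ) (Y : ℤ → Ω → ℝ) (X : ℕ → Ω → 𝒳) (θstar : Param v) : Prop where
  stationaryErgodic : IsStationaryErgodic μ Y X
  /-- `E sup_Θ ℓ_t < ∞`: the positive part of the supremum has a finite expectation -/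
  sup_ell : ∀ t : ℕ, p < t → ∫⁻ ω, ⨆ θ ∈ M.Θ, ENNReal.ofReal (ell Z M Y X t θ ω) ∂μ < ⊤
  integrable_ell : ∀ t : ℕ, p < t → Integrable (ell Z M Y X t θstar) μ
  unique_true : ∀ θ ∈ M.Θ, IsTrueParam μ Z M ℱ Y X θ → θ = θstar
  /-- the score at the true value is a square-integrable martingale difference -/
  score_adapted : ∀ t : ℕ, p < t → StronglyMeasurable[ℱ t] (score Z M Y X t θstar)
  score_memLp : ∀ t : ℕ, p < t → ∀ i, MemLp (fun ω => score Z M Y X t θstar ω i) 2 μ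
  score_condExp : ∀ t : ℕ, p < t → ∀ i,
    μ[fun ω => score Z M Y X t θstar ω i | ℱ (t - 1)] =ᵐ[μ] 0
  outerMatrix_posDef : (outerMatrix μ Z M Y X θstar).PosDef
  infoMatrix_posDef : (infoMatrix μ Z M Y X θstar).PosDef
  sup_hess : ∃ ξ > 0, ∀ t : ℕ, p < t →
    ∫⁻ ω, ⨆ θ ∈ Metric.ball θstar ξ, ‖hess Z M Y X t θ ω‖ₑ ∂μ < ⊤

/-- `θhat T` is a maximum likelihood estimator from the first `T` observations: a minimizer over
`Θ` of the negative log-likelihood. -/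
def IsMLE (μ : Measure Ω) (Z : ErrorDist) (M : ATModel v p d 𝒳) (Y : ℤ → Ω → ℝ)
    (X : ℕ → Ω → 𝒳) (θhat : ℕ → Ω → Param v) : Prop :=
  ∀ T : ℕ, ∀ᵐ ω ∂μ, θhat T ω ∈ M.Θ ∧
    IsMinOn (fun θ => -logLik Z M Y X T θ ω) M.Θ (θhat T ω)

/-- Consistency of a sequence of matrix-valued estimators: every entry converges in
probability. -/
def IsConsistent (μ : Measure Ω) (A : ℕ → Ω → Matrix (Fin v) (Fin v) ℝ)
    (A₀ : Matrix (Fin v) (Fin v) ℝ) : Prop :=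
  ∀ i j, TendstoInMeasure μ (fun T ω => A T ω i j) atTop (fun _ => A₀ i j)

end

end ATM

/-! Every observation with its features and lags is one data point `obs`. For times beyond `p` these
points have a common law `P` and obey a weak law of large numbers (`IsData.weakLawObs`), by the mean
ergodic theorem in `L¹`. The first `p` terms involve the starting values; they are bounded by a
finite random variable, locally uniformly in the parameter, and vanish after division by `T`.

Consistency of the estimator is Wald's argument. With `D` the log-likelihood ratio of `θ` against
`θstar`, the inequality `D + 1 ≤ exp D` and the fact that a likelihood ratio integrates to at most
one give `E (D + 1)⁺ ≤ 1`. Equality forces `D = 0` almost surely, hence equal conditional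
distribution functions, hence `θ = θstar` by uniqueness of the true value. The strict inequality
survives taking the supremum over a small ball, and compactness covers the rest of `Θ`.

For the Hessian, continuity in `θ` and the integrable local envelope make the mean oscillation of
`𝒥_t` near `θstar` small, so the average at the estimator has the same limit as the average at
`θstar` (`LocalScore.tendsto_average_H`).

The outer product is the delicate part: no uniform second moment of the score is assumed, and the
envelope `w` of the Hessian is only integrable. The mean value inequality bounds the average of
`|∇_t(θhat) - ∇_t(θstar)|²` by the product of `T ‖θhat - θstar‖²` and `T⁻² ∑ w_t²`. The second
factor tends to zero in probability because `E w` is finite (`WeakLawObs.tendsto_sum_sq_div_sq`).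
The first is bounded in probability: an interior maximizer solves the score equations, the mean
Hessian is nonsingular, and the score at `θstar`, a sum of martingale differences, has variance of
order `T` (`LocalScore.tendsto_sq_norm_sub_mul`). Cauchy–Schwarz then reduces the average outer
product to `θstar`, where the weak law applies (`LocalScore.tendsto_average_outer`). -/

open scoped ENNReal Topology

/-! ### Convergence in outer probability as convergence along a filter; no measurability of the
estimator is needed. -/

/-- The filter of the events in `ℕ × Ω` whose probability tends to one. Convergence along it is
convergence in (outer) probability. -/
def probFilter {Ω : Type*} [MeasurableSpace Ω] (μ : Measure Ω) : Filter (ℕ × Ω) where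
  sets := {A | Tendsto (fun T => μ {ω | (T, ω) ∉ A}) atTop (𝓝 0)}
  univ_sets := by simp
  sets_of_superset := by
    intro A B hA hAB
    refine tendsto_of_tendsto_of_tendsto_of_le_of_le tendsto_const_nhds hA
      (fun _ => zero_le) fun T => measure_mono fun ω h h' => h (hAB h')
  inter_sets := by
    intro A B hA hB
    have h := Tendsto.add hA hB
    rw [add_zero] at h
    refine tendsto_of_tendsto_of_tendsto_of_le_of_le tendsto_const_nhds h
      (fun _ => zero_le) fun T => (measure_mono ?_).trans (measure_union_le _ _)
    intro ω h
    by_contra h'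
    simp only [Set.mem_union, Set.mem_ofPred_eq, not_or, not_not] at h'
    exact h h'

section ProbFilter

variable {Ω : Type*} [MeasurableSpace Ω] {μ : Measure Ω}

lemma eventually_probFilter {q : ℕ × Ω → Prop} :
    (∀ᶠ z in probFilter μ, q z) ↔ Tendsto (fun T => μ {ω | ¬ q (T, ω)}) atTop (𝓝 0) := Iff.rfl

lemma eventually_probFilter_of_ae {q : ℕ × Ω → Prop} (h : ∀ T, ∀ᵐ ω ∂μ, q (T, ω)) :
    ∀ᶠ z in probFilter μ, q z := by
  rw [eventually_probFilter]
  have : (fun T => μ {ω | ¬ q (T, ω)}) = fun _ => 0 := funext fun T => h T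
  rw [this]
  exact tendsto_const_nhds

lemma eventually_probFilter_of_atTop {q : ℕ → Prop} (h : ∀ᶠ T in atTop, q T) :
    ∀ᶠ z in probFilter μ, q z.1 := by
  rw [eventually_probFilter]
  refine tendsto_const_nhds.congr' ?_
  filter_upwards [h] with T hT
  simp [hT]

lemma tendsto_fst_probFilter : Tendsto Prod.fst (probFilter μ) atTop := fun _ hA =>
  eventually_probFilter_of_atTop hA

lemma tendstoInMeasure_of_tendsto_probFilter {f : ℕ → Ω → ℝ} {c : ℝ}
    (h : Tendsto (fun z : ℕ × Ω => f z.1 z.2) (probFilter μ) (𝓝 c)) :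
    TendstoInMeasure μ f atTop (fun _ => c) := by
  rw [tendstoInMeasure_iff_norm]
  intro ε hε
  have := eventually_probFilter.1 ((Metric.tendsto_nhds.1 h) ε hε)
  simpa [dist_eq_norm] using this

lemma tendsto_probFilter_of_tendstoInMeasure {f : ℕ → Ω → ℝ} {c : ℝ}
    (h : TendstoInMeasure μ f atTop (fun _ => c)) :
    Tendsto (fun z : ℕ × Ω => f z.1 z.2) (probFilter μ) (𝓝 c) := by
  rw [tendstoInMeasure_iff_norm] at h
  rw [Metric.tendsto_nhds]
  intro ε hε
  rw [eventually_probFilter]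
  simpa [dist_eq_norm] using h ε hε

/-- A finite random variable divided by the sample size vanishes in probability. -/
lemma tendsto_div_probFilter [IsFiniteMeasure μ] {C : Ω → ℝ} (hC : Measurable C) :
    Tendsto (fun z : ℕ × Ω => C z.2 / z.1) (probFilter μ) (𝓝 0) := by
  refine tendsto_probFilter_of_tendstoInMeasure (f := fun T ω => C ω / T) ?_
  refine tendstoInMeasure_of_tendsto_ae (fun T => (hC.div_const _).aestronglyMeasurable) ?_
  exact ae_of_all _ fun ω => tendsto_const_div_atTop_nhds_zero_nat _

/-- A product of a sequence that is bounded in mean and of one that vanishes in probability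
vanishes in probability. -/
lemma tendsto_mul_probFilter {X Z : ℕ × Ω → ℝ} {c : ℝ≥0∞} (hc : c ≠ ⊤) (hX : ∀ z, 0 ≤ X z)
    (hXm : ∀ T, AEMeasurable (fun ω => X (T, ω)) μ)
    (hXc : ∀ᶠ T in atTop, ∫⁻ ω, ENNReal.ofReal (X (T, ω)) ∂μ ≤ c)
    (hZ : Tendsto Z (probFilter μ) (𝓝 0)) :
    Tendsto (fun z => X z * Z z) (probFilter μ) (𝓝 0) := by
  rw [Metric.tendsto_nhds]
  intro ε hε
  rw [eventually_probFilter, ENNReal.tendsto_nhds_zero]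
  intro η hη
  -- By Markov's inequality `X ≥ m` has probability at most `c / m`. Where `X < m`, it is enough
  -- that `|Z| < ε / m`.
  obtain ⟨m, hm0, hm⟩ : ∃ m : ℝ, 0 < m ∧ c / ENNReal.ofReal m ≤ η / 2 := by
    have h1 : Tendsto (fun m : ℕ => c / (m : ℝ≥0∞)) atTop (𝓝 0) := by
      have := ENNReal.Tendsto.const_div (a := c) ENNReal.tendsto_nat_nhds_top (Or.inr hc)
      simpa using this
    have h2 := (ENNReal.tendsto_nhds_zero.1 h1) (η / 2) (ENNReal.half_pos hη.ne')
    obtain ⟨m, hm, hm'⟩ := (h2.and (eventually_gt_atTop 0)).exists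
    exact ⟨m, by exact_mod_cast hm', by simpa using hm⟩
  have hZ' := eventually_probFilter.1 ((Metric.tendsto_nhds.1 hZ) (ε / m) (by positivity))
  filter_upwards [(ENNReal.tendsto_nhds_zero.1 hZ') (η / 2) (ENNReal.half_pos hη.ne'), hXc]
    with T hT hXT
  have hsub : {ω | ¬ dist (X (T, ω) * Z (T, ω)) 0 < ε} ⊆
      {ω | ENNReal.ofReal m ≤ ENNReal.ofReal (X (T, ω))} ∪ {ω | ¬ dist (Z (T, ω)) 0 < ε / m} := by
    intro ω h
    by_contra h'
    simp only [Set.mem_union, Set.mem_ofPred_eq, not_or, not_not, dist_zero_right, not_le,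
      Real.norm_eq_abs] at h' h
    apply h
    rw [abs_mul, abs_of_nonneg (hX _)]
    have h1 : X (T, ω) < m := by
      by_contra hh
      exact absurd h'.1 (not_lt.2 (ENNReal.ofReal_le_ofReal (not_lt.1 hh)))
    calc X (T, ω) * |Z (T, ω)| ≤ m * |Z (T, ω)| := by gcongr
      _ < m * (ε / m) := by gcongr; exact h'.2
      _ = ε := by field_simp
  calc μ {ω | ¬ dist (X (T, ω) * Z (T, ω)) 0 < ε} ≤ _ := measure_mono hsub
    _ ≤ _ := measure_union_le _ _
    _ ≤ η / 2 + η / 2 := by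
        gcongr
        refine (meas_ge_le_lintegral_div (hXm T).ennreal_ofReal ?_ ENNReal.ofReal_ne_top).trans ?_
        · simpa using hm0
        · exact (ENNReal.div_le_div_right hXT _).trans hm
    _ = η := ENNReal.add_halves η

end ProbFilter

/-! ### The mean ergodic theorem for integrable functions. -/

section MeanErgodic

lemma ContinuousLinearMap.exists_tendsto_birkhoffAverage {E : Type*} [NormedAddCommGroup E]
    [InnerProductSpace ℝ E] [CompleteSpace E] (V : E →L[ℝ] E) (hV : ‖V‖ ≤ 1) (x : E) :
    ∃ y, V y = y ∧ Tendsto (birkhoffAverage ℝ V id · x) atTop (𝓝 y) := by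
  have := V.isClosed_eqLocus 1 |>.completeSpace_coe
  exact ⟨_, LinearMap.mem_eqLocus.1 (Submodule.coe_mem _),
    V.tendsto_birkhoffAverage_orthogonalProjection hV x⟩

variable {α : Type*} [MeasurableSpace α] {Q : Measure α} {f : α → α}

lemma MeasureTheory.MeasurePreserving.memLp_birkhoffAverage (hf : MeasurePreserving f Q Q)
    {q : ℝ≥0∞} {g : α → ℝ} (hg : MemLp g q Q) (n : ℕ) :
    MemLp (birkhoffAverage ℝ f g n) q Q := by
  have : birkhoffAverage ℝ f g n = (n : ℝ)⁻¹ • ∑ k ∈ Finset.range n, fun x => g (f^[k] x) := by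
    ext x; simp [birkhoffAverage, birkhoffSum]
  rw [this]
  exact (memLp_finsetSum' _ fun k _ =>
    hg.comp_measurePreserving (hf.iterate k)).const_smul _

lemma MeasureTheory.MeasurePreserving.integral_birkhoffAverage (hf : MeasurePreserving f Q Q)
    {g : α → ℝ} (hg : Integrable g Q) {n : ℕ} (hn : n ≠ 0) :
    ∫ x, birkhoffAverage ℝ f g n x ∂Q = ∫ x, g x ∂Q := by
  simp only [birkhoffAverage, birkhoffSum, smul_eq_mul]
  rw [integral_const_mul, integral_finsetSum (Finset.range n) (f := fun k x => g (f^[k] x))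
    fun k _ => (hf.iterate k).integrable_comp_of_integrable hg]
  have (k : ℕ) : ∫ x, g (f^[k] x) ∂Q = ∫ x, g x ∂Q := by
    have h := integral_map (hf.iterate k).measurable.aemeasurable (f := g)
      (by rw [(hf.iterate k).map_eq]; exact hg.1)
    rw [(hf.iterate k).map_eq] at h
    exact h.symm
  simp only [this, Finset.sum_const, Finset.card_range, nsmul_eq_mul]
  field_simp

lemma MeasureTheory.MeasurePreserving.eLpNorm_birkhoffAverage_le (hf : MeasurePreserving f Q Q)
    {g : α → ℝ} (hg : AEStronglyMeasurable g Q) (n : ℕ) :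
    eLpNorm (birkhoffAverage ℝ f g n) 1 Q ≤ eLpNorm g 1 Q := by
  have h1 : birkhoffAverage ℝ f g n = (n : ℝ)⁻¹ • ∑ k ∈ Finset.range n, fun x => g (f^[k] x) := by
    ext x; simp [birkhoffAverage, birkhoffSum]
  rcases Nat.eq_zero_or_pos n with rfl | hn
  · simp [h1]
  rw [h1, eLpNorm_const_smul]
  calc ‖(n : ℝ)⁻¹‖ₑ * eLpNorm (∑ k ∈ Finset.range n, fun x => g (f^[k] x)) 1 Q
      ≤ ‖(n : ℝ)⁻¹‖ₑ * ∑ k ∈ Finset.range n, eLpNorm (fun x => g (f^[k] x)) 1 Q := by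
        gcongr
        exact eLpNorm_sum_le (fun k _ => hg.comp_measurePreserving (hf.iterate k)) le_rfl
    _ = ‖(n : ℝ)⁻¹‖ₑ * (n * eLpNorm g 1 Q) := by
        congr 1
        have (k : ℕ) : eLpNorm (fun x => g (f^[k] x)) 1 Q = eLpNorm g 1 Q :=
          eLpNorm_comp_measurePreserving (p := 1) hg (hf.iterate k)
        simp [this]
    _ = eLpNorm g 1 Q := by
        rw [← mul_assoc, enorm_inv (by positivity)]
        rw [show ‖(n : ℝ)‖ₑ = n by simp]
        rw [ENNReal.inv_mul_cancel (by exact_mod_cast hn.ne') (by simp), one_mul]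

/-- Von Neumann's theorem for the Koopman operator `g ↦ g ∘ f` on `L²`: the averages converge to a
fixed vector, which is an almost everywhere invariant function and therefore constant by ergodicity.
-/
lemma Ergodic.exists_tendsto_birkhoffAverage_memLp_two [IsProbabilityMeasure Q]
    (hf : Ergodic f Q) {g : α → ℝ} (hg : MemLp g 2 Q) :
    ∃ c : ℝ, Tendsto (fun n => eLpNorm (fun x => birkhoffAverage ℝ f g n x - c) 2 Q) atTop
      (𝓝 0) := by
  have hmp := hf.toMeasurePreserving
  let U : Lp ℝ 2 Q →ₗᵢ[ℝ] Lp ℝ 2 Q := Lp.compMeasurePreservingₗᵢ ℝ f hmp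
  have hU (g' : α → ℝ) (h : MemLp g' 2 Q) :
      U (h.toLp) = (h.comp_measurePreserving hmp).toLp := Lp.toLp_compMeasurePreserving h hmp
  obtain ⟨y, hyfix, hlim⟩ := U.toContinuousLinearMap.exists_tendsto_birkhoffAverage
    U.norm_toContinuousLinearMap_le hg.toLp
  replace hyfix : U y = y := hyfix
  obtain ⟨c, hc⟩ : ∃ c, (y : α → ℝ) =ᵐ[Q] Function.const α c := by
    refine hf.ae_eq_const_of_ae_eq_comp_ae (Lp.aestronglyMeasurable y) ?_
    have := Lp.coeFn_compMeasurePreserving y hmp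
    have h2 : Lp.compMeasurePreserving f hmp y = y := hyfix
    rw [h2] at this
    exact this.symm
  refine ⟨c, ?_⟩
  have hiter (k : ℕ) : U^[k] hg.toLp = (hg.comp_measurePreserving (hmp.iterate k)).toLp := by
    induction k with
    | zero => rfl
    | succ k ih =>
      rw [Function.iterate_succ_apply', ih, hU]
      congr 1
  have hav (n : ℕ) : (birkhoffAverage ℝ U id n hg.toLp : Lp ℝ 2 Q)
      =ᵐ[Q] birkhoffAverage ℝ f g n := by
    have h1 : birkhoffAverage ℝ U id n hg.toLp
        = (n : ℝ)⁻¹ • ∑ k ∈ Finset.range n, (hg.comp_measurePreserving (hmp.iterate k)).toLp := by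
      simp [birkhoffAverage, birkhoffSum, hiter]
    rw [h1]
    have h2 := Lp.coeFn_smul (n : ℝ)⁻¹
      (∑ k ∈ Finset.range n, (hg.comp_measurePreserving (hmp.iterate k)).toLp)
    have h3 := Lp.coeFn_finsetSum (Finset.range n)
      (fun k => (hg.comp_measurePreserving (hmp.iterate k)).toLp)
    have h4 : ∀ᵐ x ∂Q, ∀ k, (MemLp.toLp _ (hg.comp_measurePreserving (hmp.iterate k)) : α → ℝ) x = g (f^[k] x) :=
      ae_all_iff.2 fun k => MemLp.coeFn_toLp _
    filter_upwards [h2, h3, h4] with x h2 h3 h4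
    rw [h2, Pi.smul_apply, h3]
    simp [birkhoffAverage, birkhoffSum, h4]
  have hnorm := (Lp.tendsto_Lp_iff_tendsto_eLpNorm' _ _).1 hlim
  refine hnorm.congr fun n => eLpNorm_congr_ae ?_
  filter_upwards [hav n, hc] with x h1 h2
  simp only [Pi.sub_apply]
  rw [h2, ← h1]
  rfl

/-- The constant limit must be the mean of `g`, since averaging along a measure-preserving map keeps
the integral and `L¹` convergence passes to integrals. -/
lemma Ergodic.tendsto_eLpNorm_birkhoffAverage_memLp_two [IsProbabilityMeasure Q]
    (hf : Ergodic f Q) {g : α → ℝ} (hg : MemLp g 2 Q) :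
    Tendsto (fun n => eLpNorm (fun x => birkhoffAverage ℝ f g n x - ∫ x, g x ∂Q) 1 Q) atTop
      (𝓝 0) := by
  obtain ⟨c, hc⟩ := hf.exists_tendsto_birkhoffAverage_memLp_two hg
  have hmp := hf.toMeasurePreserving
  have hmem (n : ℕ) : MemLp (fun x => birkhoffAverage ℝ f g n x - c) 2 Q :=
    (hmp.memLp_birkhoffAverage hg n).sub (memLp_const c)
  have h1 : Tendsto (fun n => eLpNorm (fun x => birkhoffAverage ℝ f g n x - c) 1 Q) atTop (𝓝 0) :=
    tendsto_of_tendsto_of_tendsto_of_le_of_le tendsto_const_nhds hc (fun _ => zero_le)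
      fun n => eLpNorm_le_eLpNorm_of_exponent_le (by norm_num) (hmem n).1
  have h2 : Tendsto (fun n => ∫ x, birkhoffAverage ℝ f g n x ∂Q) atTop (𝓝 (∫ _, c ∂Q)) := by
    refine tendsto_integral_of_L1' (fun _ => c) aestronglyMeasurable_const (Eventually.of_forall
      fun n => (hmp.memLp_birkhoffAverage hg n).integrable (by norm_num)) ?_
    exact h1
  have h3 : ∫ x, g x ∂Q = c := by
    have h4 : Tendsto (fun n => ∫ x, birkhoffAverage ℝ f g n x ∂Q) atTop (𝓝 (∫ x, g x ∂Q)) :=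
      tendsto_const_nhds.congr' (by
        filter_upwards [eventually_ne_atTop 0] with n hn
        exact (hmp.integral_birkhoffAverage (hg.integrable (by norm_num)) hn).symm)
    have := tendsto_nhds_unique h4 h2
    simpa using this
  rw [h3]
  exact h1

/-- The mean ergodic theorem in `L¹`. -/
theorem Ergodic.tendsto_eLpNorm_birkhoffAverage [IsProbabilityMeasure Q]
    (hf : Ergodic f Q) {g : α → ℝ} (hg : Integrable g Q) :
    Tendsto (fun n => eLpNorm (fun x => birkhoffAverage ℝ f g n x - ∫ x, g x ∂Q) 1 Q) atTop
      (𝓝 0) := by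
  have hmp := hf.toMeasurePreserving
  rw [ENNReal.tendsto_nhds_zero]
  intro ε hε
  have hε3 : ε / 3 ≠ 0 := by simp [hε.ne']
  obtain ⟨g', hg', -⟩ := (memLp_one_iff_integrable.2 hg).exists_simpleFunc_eLpNorm_sub_lt
    (by simp) hε3
  have hg'2 : MemLp g' 2 Q := g'.memLp_of_isFiniteMeasure 2 Q
  have hg'1 : Integrable g' Q := hg'2.integrable (by norm_num)
  filter_upwards [(ENNReal.tendsto_nhds_zero.1
    (hf.tendsto_eLpNorm_birkhoffAverage_memLp_two hg'2)) (ε / 3) (pos_iff_ne_zero.2 hε3)] with n hn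
  -- Three errors of size `ε / 3`: the average of `g - g'` (averaging is an `L¹` contraction), the
  -- square-integrable case for `g'`, and the difference of the two means.
  have hdec : (fun x => birkhoffAverage ℝ f g n x - ∫ x, g x ∂Q)
      = (birkhoffAverage ℝ f (g - ⇑g') n + fun x => birkhoffAverage ℝ f g' n x - ∫ x, g' x ∂Q)
        + fun _ => (∫ x, g' x ∂Q - ∫ x, g x ∂Q) := by
    ext x
    simp only [Pi.add_apply, birkhoffAverage, birkhoffSum, Pi.sub_apply, Finset.sum_sub_distrib,
      smul_sub]
    ring
  have hm1 := (hmp.memLp_birkhoffAverage (memLp_one_iff_integrable.2 (hg.sub hg'1)) n).1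
  have hm2 : AEStronglyMeasurable (fun x => birkhoffAverage ℝ f g' n x - ∫ x, g' x ∂Q) Q :=
    (hmp.memLp_birkhoffAverage hg'2 n).1.sub aestronglyMeasurable_const
  rw [hdec]
  calc _ ≤ _ := eLpNorm_add_le (hm1.add hm2) aestronglyMeasurable_const le_rfl
    _ ≤ _ := add_le_add_left (eLpNorm_add_le hm1 hm2 le_rfl) _
    _ ≤ ε / 3 + ε / 3 + ε / 3 := by
      gcongr
      · exact (hmp.eLpNorm_birkhoffAverage_le (hg.sub hg'1).1 n).trans hg'.le
      · rw [eLpNorm_const _ (by simp) (IsProbabilityMeasure.ne_zero Q)]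
        simp only [measure_univ, ENNReal.toReal_one, div_one, ENNReal.rpow_one, mul_one]
        rw [← integral_sub hg'1 hg]
        refine (enorm_integral_le_lintegral_enorm _).trans ?_
        refine le_trans (le_of_eq ?_) hg'.le
        rw [eLpNorm_one_eq_lintegral_enorm]
        exact lintegral_congr fun x => by rw [Pi.sub_apply, enorm_sub_rev]
    _ = ε := ENNReal.add_thirds ε

end MeanErgodic

/-! ### Random functions of a parameter: suprema, bounds and derivatives. -/

section ParametricSup

variable {E S : Type*} [MeasurableSpace S]

/-- By continuity on `K` the uncountable supremum equals the one over a countable dense subset. -/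
lemma measurable_biSup_of_continuousOn [TopologicalSpace E] [SecondCountableTopology E]
    {K : Set E} {f : E → S → ℝ≥0∞} (hc : ∀ s, ContinuousOn (fun θ => f θ s) K)
    (hm : ∀ θ ∈ K, Measurable (f θ)) : Measurable fun s => ⨆ θ ∈ K, f θ s := by
  obtain ⟨D, hD, hDd⟩ := TopologicalSpace.exists_countable_dense K
  have h (s : S) : ⨆ θ ∈ K, f θ s = ⨆ θ ∈ D, f (θ : E) s := by
    refine le_antisymm (iSup₂_le fun θ hθ => ?_) (iSup₂_le fun θ _ =>
      le_iSup₂ (f := fun (η : E) (_ : η ∈ K) => f η s) (θ : E) θ.2)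
    have hcl : IsClosed {x : K | f (x : E) s ≤ ⨆ θ ∈ D, f (θ : E) s} :=
      isClosed_le (hc s).domRestrict continuous_const
    have hsub : D ⊆ {x : K | f (x : E) s ≤ ⨆ θ ∈ D, f (θ : E) s} := fun x hx =>
      le_iSup₂ (f := fun (η : K) (_ : η ∈ D) => f (η : E) s) x hx
    have := hcl.closure_subset_iff.2 hsub
    rw [hDd.closure_eq] at this
    exact this (Set.mem_univ (⟨θ, hθ⟩ : K))
  simp only [h]
  exact Measurable.biSup D hD fun θ _ => hm θ θ.2

lemma tendsto_biSup_inter_ball [PseudoMetricSpace E] {K : Set E} {θ₀ : E} (hθ₀ : θ₀ ∈ K)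
    {f : E → ℝ≥0∞} (hf : ContinuousWithinAt f K θ₀) :
    Tendsto (fun n : ℕ => ⨆ θ ∈ K ∩ Metric.ball θ₀ (1 / ((n : ℝ) + 1)), f θ) atTop
      (𝓝 (f θ₀)) := by
  refine tendsto_order.2 ⟨fun a ha => Eventually.of_forall fun n => ha.trans_le ?_,
    fun b hb => ?_⟩
  · exact le_iSup₂ (f := fun (η : E) (_ : η ∈ K ∩ Metric.ball θ₀ (1 / ((n : ℝ) + 1))) => f η) θ₀
      ⟨hθ₀, Metric.mem_ball_self (by positivity)⟩
  · obtain ⟨c, hc, hcb⟩ := exists_between hb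
    have h1 : ∀ᶠ θ in 𝓝[K] θ₀, f θ < c := hf.eventually_lt_const hc
    obtain ⟨ε, hε, hsub⟩ := Metric.mem_nhdsWithin_iff.1 h1
    filter_upwards [tendsto_one_div_add_atTop_nhds_zero_nat.eventually_lt_const hε] with n hn
    refine lt_of_le_of_lt (iSup₂_le fun θ hθ => ?_) hcb
    exact (hsub ⟨Metric.ball_subset_ball hn.le hθ.2, hθ.1⟩ : f θ < c).le

/-- The mean of the supremum of a dominated continuous random function over a small ball is close
to the mean at the centre. -/
lemma exists_lintegral_biSup_inter_ball_lt [PseudoMetricSpace E] [SecondCountableTopology E]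
    {P : Measure S} {K : Set E} {θ₀ : E} (hθ₀ : θ₀ ∈ K) {f : E → S → ℝ≥0∞}
    (hc : ∀ s, ContinuousOn (fun θ => f θ s) K) (hm : ∀ θ ∈ K, Measurable (f θ))
    {B : S → ℝ≥0∞} (hB : ∫⁻ s, B s ∂P ≠ ⊤) (hfB : ∀ θ ∈ K, ∀ s, f θ s ≤ B s)
    {c : ℝ≥0∞} (hlt : ∫⁻ s, f θ₀ s ∂P < c) :
    ∃ δ > 0, ∫⁻ s, ⨆ θ ∈ K ∩ Metric.ball θ₀ δ, f θ s ∂P < c := by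
  -- Dominated convergence along the radii `1 / (n + 1)`: continuity sends the supremum over the
  -- ball to the value at its centre.
  have h := tendsto_lintegral_of_dominated_convergence (μ := P)
    (F := fun n s => ⨆ θ ∈ K ∩ Metric.ball θ₀ (1 / ((n : ℝ) + 1)), f θ s) (f := f θ₀) B
    (fun n => measurable_biSup_of_continuousOn (fun s => (hc s).mono Set.inter_subset_left)
      fun θ hθ => hm θ hθ.1)
    (fun n => ae_of_all _ fun s => iSup₂_le fun θ hθ => hfB θ hθ.1 s) hB
    (ae_of_all _ fun s => tendsto_biSup_inter_ball hθ₀ (hc s θ₀ hθ₀))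
  obtain ⟨n, hn⟩ := (h.eventually_lt_const hlt).exists
  exact ⟨1 / ((n : ℝ) + 1), by positivity, hn⟩

/-- A continuous random function on a compact set has a finite measurable bound. -/
lemma IsCompact.exists_measurable_abs_le [TopologicalSpace E] [SecondCountableTopology E]
    {K : Set E} (hK : IsCompact K) {g : E → S → ℝ} (hc : ∀ s, ContinuousOn (fun θ => g θ s) K)
    (hm : ∀ θ ∈ K, Measurable (g θ)) :
    ∃ C : S → ℝ, Measurable C ∧ ∀ s, ∀ θ ∈ K, |g θ s| ≤ C s := by
  refine ⟨fun s => (⨆ θ ∈ K, ENNReal.ofReal |g θ s|).toReal, ?_, fun s θ hθ => ?_⟩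
  · exact (measurable_biSup_of_continuousOn
      (fun s => ENNReal.continuous_ofReal.comp_continuousOn (hc s).abs)
      fun θ hθ => (hm θ hθ).abs.ennreal_ofReal).ennreal_toReal
  -- `toReal` sends `⊤` to `0`, so the bound is valid only because compactness makes the supremum
  -- finite.
  · obtain ⟨C, hC⟩ := hK.exists_bound_of_continuousOn (hc s)
    refine (ENNReal.ofReal_le_iff_le_toReal ?_).1
      (le_iSup₂ (f := fun (η : E) (_ : η ∈ K) => ENNReal.ofReal |g η s|) θ hθ)
    exact ne_top_of_le_ne_top (ENNReal.ofReal_ne_top (r := C))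
      (iSup₂_le fun η hη => ENNReal.ofReal_le_ofReal (hC η hη))

/-- Directional derivatives with respect to a parameter are measurable. -/
lemma measurable_fderiv_apply_param [NormedAddCommGroup E] [NormedSpace ℝ E] {U : Set E}
    (hU : IsOpen U) {g : E → S → ℝ} (hm : ∀ θ ∈ U, Measurable (g θ)) {θ : E} (hθ : θ ∈ U)
    (hd : ∀ s, DifferentiableAt ℝ (fun η => g η s) θ) (e : E) :
    Measurable fun s => fderiv ℝ (fun η => g η s) θ e := by
  have hlim : Tendsto (fun n : ℕ => θ + ((n : ℝ) + 1)⁻¹ • e) atTop (𝓝 θ) := by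
    have h1 : Tendsto (fun n : ℕ => ((n : ℝ) + 1)⁻¹) atTop (𝓝 0) := by
      simpa [one_div] using tendsto_one_div_add_atTop_nhds_zero_nat (𝕜 := ℝ)
    simpa using (h1.smul_const e).const_add θ
  -- The difference quotients start at index `N`, from which on the shifted parameter stays in `U`,
  -- where measurability is known.
  obtain ⟨N, hN⟩ := eventually_atTop.1 (hlim.eventually (hU.mem_nhds hθ))
  refine measurable_of_tendsto_metrizable
    (f := fun (n : ℕ) s => (((n + N : ℕ) : ℝ) + 1) * (g (θ + (((n + N : ℕ) : ℝ) + 1)⁻¹ • e) s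
      - g θ s)) (fun n => ?_) ?_
  · exact ((hm _ (hN _ (Nat.le_add_left _ _))).sub (hm θ hθ)).const_mul _
  · rw [tendsto_pi_nhds]
    intro s
    have hN' : Tendsto (fun n : ℕ => ((n + N : ℕ) : ℝ) + 1) atTop atTop :=
      tendsto_atTop_add_const_right _ _
        (tendsto_natCast_atTop_atTop.comp (tendsto_add_atTop_nat N))
    exact ((hd s).hasFDerivAt.lim_real e).comp hN'

end ParametricSup

/-! ### The weak law for the data points and Wald's consistency theorem. -/

/-- From time `p + 1` on the observations `s t` have the law `P` and satisfy the weak law of large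
numbers. -/
structure WeakLawObs {Ω S : Type*} [MeasurableSpace Ω] [MeasurableSpace S] (μ : Measure Ω) (p : ℕ)
    (s : ℕ → Ω → S) (P : Measure S) : Prop where
  measurable : ∀ t, 1 ≤ t → Measurable (s t)
  map_eq : ∀ t, p < t → μ.map (s t) = P
  tendsto_average : ∀ g : S → ℝ, Integrable g P →
    Tendsto (fun z : ℕ × Ω => (∑ t ∈ Finset.Ioc p z.1, g (s t z.2)) / z.1) (probFilter μ)
      (𝓝 (∫ x, g x ∂P))

namespace WeakLawObs

variable {Ω S E : Type*} [MeasurableSpace Ω] [MeasurableSpace S] {μ : Measure Ω}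
  {p : ℕ} {s : ℕ → Ω → S} {P : Measure S}

lemma ae_of_ae (hs : WeakLawObs μ p s P) {q : S → Prop} (hq : ∀ᵐ x ∂P, q x) :
    ∀ᵐ ω ∂μ, ∀ t, p < t → q (s t ω) := by
  rw [ae_all_iff]
  intro t
  by_cases ht : p < t
  · rw [← hs.map_eq t ht] at hq
    filter_upwards [ae_of_ae_map (hs.measurable t (by omega)).aemeasurable hq] with ω h _ using h
  · exact ae_of_all _ fun ω h => absurd h ht

lemma isProbabilityMeasure [IsProbabilityMeasure μ] (hs : WeakLawObs μ p s P) :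
    IsProbabilityMeasure P := by
  rw [← hs.map_eq (p + 1) (by omega)]
  exact Measure.isProbabilityMeasure_map (hs.measurable _ (by omega)).aemeasurable

/-- A locally bounded random function has bounded sums over the first `p` observations. -/
lemma exists_initial_bound [TopologicalSpace E] [SecondCountableTopology E]
    (hs : WeakLawObs μ p s P) {K : Set E} (hK : IsCompact K) {g : E → S → ℝ}
    (hc : ∀ x, ContinuousOn (fun θ => g θ x) K) (hm : ∀ θ ∈ K, Measurable (g θ))
    {θhat : ℕ × Ω → E} (hθ : ∀ᶠ z in probFilter μ, θhat z ∈ K) :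
    ∃ C : Ω → ℝ, Measurable C ∧
      ∀ᶠ z in probFilter μ, |∑ t ∈ Finset.Icc 1 p, g (θhat z) (s t z.2)| ≤ C z.2 := by
  obtain ⟨C, hCm, hC⟩ := hK.exists_measurable_abs_le hc hm
  refine ⟨fun ω => ∑ t ∈ Finset.Icc 1 p, C (s t ω),
    Finset.measurable_sum _ fun t ht => hCm.comp (hs.measurable t (Finset.mem_Icc.1 ht).1), ?_⟩
  filter_upwards [hθ] with z hz
  exact (Finset.abs_sum_le_sum_abs _ _).trans (Finset.sum_le_sum fun t _ => hC _ _ hz)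

/-- The first `p` observations do not matter for averages of a locally bounded random function. -/
lemma tendsto_initial [IsFiniteMeasure μ] [TopologicalSpace E] [SecondCountableTopology E]
    (hs : WeakLawObs μ p s P) {K : Set E} (hK : IsCompact K) {g : E → S → ℝ}
    (hc : ∀ x, ContinuousOn (fun θ => g θ x) K) (hm : ∀ θ ∈ K, Measurable (g θ))
    {θhat : ℕ × Ω → E} (hθ : ∀ᶠ z in probFilter μ, θhat z ∈ K) :
    Tendsto (fun z : ℕ × Ω => (∑ t ∈ Finset.Icc 1 p, g (θhat z) (s t z.2)) / z.1)
      (probFilter μ) (𝓝 0) := by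
  obtain ⟨C, hCm, hC⟩ := hs.exists_initial_bound hK hc hm hθ
  refine squeeze_zero_norm' ?_ (tendsto_div_probFilter (μ := μ) hCm)
  filter_upwards [hC] with z hz
  rw [norm_div, Real.norm_eq_abs, Real.norm_natCast]
  gcongr

/-- Splitting off the first `p` summands. -/
lemma _root_.Finset.sum_Icc_one_eq_add {p T : ℕ} (h : p ≤ T) (f : ℕ → ℝ) :
    ∑ t ∈ Finset.Icc 1 T, f t = ∑ t ∈ Finset.Icc 1 p, f t + ∑ t ∈ Finset.Ioc p T, f t := by
  rw [← Finset.sum_union]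
  · congr 1
    ext t
    simp only [Finset.mem_Icc, Finset.mem_union, Finset.mem_Ioc]
    omega
  · rw [Finset.disjoint_left]
    intro t
    simp only [Finset.mem_Icc, Finset.mem_Ioc]
    omega

lemma eventually_le_fst (p : ℕ) : ∀ᶠ z in probFilter μ, p ≤ z.1 :=
  eventually_probFilter_of_atTop (eventually_ge_atTop p)

/-- Lets the stationary law, valid only after time `p`, control averages over all observations. -/
lemma tendsto_full_average [IsFiniteMeasure μ] [TopologicalSpace E] [SecondCountableTopology E]
    (hs : WeakLawObs μ p s P) {K : Set E} (hK : IsCompact K) {g : E → S → ℝ}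
    (hc : ∀ x, ContinuousOn (fun θ => g θ x) K) (hm : ∀ θ ∈ K, Measurable (g θ))
    {θhat : ℕ × Ω → E} (hθ : ∀ᶠ z in probFilter μ, θhat z ∈ K) {c : ℝ}
    (h : Tendsto (fun z : ℕ × Ω => (∑ t ∈ Finset.Ioc p z.1, g (θhat z) (s t z.2)) / z.1)
      (probFilter μ) (𝓝 c)) :
    Tendsto (fun z : ℕ × Ω => (∑ t ∈ Finset.Icc 1 z.1, g (θhat z) (s t z.2)) / z.1)
      (probFilter μ) (𝓝 c) := by
  have h2 := (hs.tendsto_initial hK hc hm hθ).add h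
  rw [zero_add] at h2
  refine h2.congr' ?_
  filter_upwards [eventually_le_fst p] with z hz
  rw [Finset.sum_Icc_one_eq_add hz, add_div]

section Consistency

variable [PseudoMetricSpace E] [SecondCountableTopology E] {Θ : Set E} {L : E → S → ℝ}
  {θstar : E} {θhat : ℕ × Ω → E}

/-- A maximizer of the likelihood is asymptotically not close to a parameter with a smaller mean
log-likelihood. -/
lemma exists_eventually_notMem_ball [IsProbabilityMeasure μ] (hs : WeakLawObs μ p s P)
    (hΘ : IsCompact Θ) (hc : ∀ x, ContinuousOn (fun θ => L θ x) Θ)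
    (hm : ∀ θ ∈ Θ, Measurable (L θ)) (hstar : θstar ∈ Θ)
    (hB : ∫⁻ x, ⨆ θ ∈ Θ, ENNReal.ofReal (L θ x) ∂P < ⊤) (hint : Integrable (L θstar) P)
    (hmem : ∀ᶠ z in probFilter μ, θhat z ∈ Θ)
    (hmax : ∀ᶠ z in probFilter μ, ∑ t ∈ Finset.Icc 1 z.1, L θstar (s t z.2)
      ≤ ∑ t ∈ Finset.Icc 1 z.1, L (θhat z) (s t z.2))
    {θ₀ : E} (hθ₀ : θ₀ ∈ Θ)
    (hid : ∫⁻ x, ENNReal.ofReal (L θ₀ x - L θstar x + 1) ∂P < 1) :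
    ∃ δ > 0, ∀ᶠ z in probFilter μ, θhat z ∉ Θ ∩ Metric.ball θ₀ δ := by
  have hP := hs.isProbabilityMeasure
  -- `ENNReal.ofReal` cuts the log-likelihood ratio off below at `-1`. Only the positive part of `L
  -- θ` is dominated, so some lower truncation is needed; the level `-1` fits the inequality `x + 1
  -- ≤ exp x` behind `hid`.
  set f : E → S → ℝ≥0∞ := fun θ x => ENNReal.ofReal (L θ x - L θstar x + 1) with hf
  have hfc (x : S) : ContinuousOn (fun θ => f θ x) Θ :=
    ENNReal.continuous_ofReal.comp_continuousOn
      (((hc x).sub continuousOn_const).add continuousOn_const)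
  have hfm (θ : E) (hθ : θ ∈ Θ) : Measurable (f θ) :=
    (((hm θ hθ).sub (hm _ hstar)).add_const 1).ennreal_ofReal
  have hdom : ∫⁻ x, ((⨆ θ ∈ Θ, ENNReal.ofReal (L θ x)) + (‖L θstar x‖ₑ + 1)) ∂P ≠ ⊤ := by
    rw [lintegral_add_right _ ((hm _ hstar).enorm.add_const 1),
      lintegral_add_right _ measurable_const]
    have := hint.2
    rw [HasFiniteIntegral] at this
    simp only [lintegral_const, measure_univ, mul_one]
    exact ENNReal.add_ne_top.2 ⟨hB.ne, ENNReal.add_ne_top.2 ⟨this.ne, ENNReal.one_ne_top⟩⟩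
  obtain ⟨δ, hδ, hW⟩ := exists_lintegral_biSup_inter_ball_lt (P := P) hθ₀ hfc hfm hdom
    (fun θ hθ x => by
      calc f θ x ≤ ENNReal.ofReal (L θ x + (|L θstar x| + 1)) :=
            ENNReal.ofReal_le_ofReal (by linarith [neg_abs_le (L θstar x)])
        _ ≤ ENNReal.ofReal (L θ x) + ENNReal.ofReal (|L θstar x| + 1) := ENNReal.ofReal_add_le
        _ ≤ _ := by
          gcongr
          · exact le_iSup₂ (f := fun (η : E) (_ : η ∈ Θ) => ENNReal.ofReal (L η x)) θ hθ
          · rw [ENNReal.ofReal_add (abs_nonneg _) zero_le_one, ENNReal.ofReal_one,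
              ← Real.norm_eq_abs, ofReal_norm]) hid
  refine ⟨δ, hδ, ?_⟩
  set W : S → ℝ≥0∞ := fun x => ⨆ θ ∈ Θ ∩ Metric.ball θ₀ δ, f θ x with hWdef
  have hWm : Measurable W := measurable_biSup_of_continuousOn
    (fun x => (hfc x).mono Set.inter_subset_left) fun θ hθ => hfm θ hθ.1
  have hWne : ∫⁻ x, W x ∂P ≠ ⊤ := (hW.trans ENNReal.one_lt_top).ne
  have hWfin : ∀ᵐ x ∂P, W x < ⊤ := ae_lt_top hWm hWne
  have hWint : Integrable (fun x => (W x).toReal) P := integrable_toReal_of_lintegral_ne_top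
    hWm.aemeasurable hWne
  have hWlt : ∫ x, (W x).toReal ∂P < 1 := by
    rw [integral_toReal hWm.aemeasurable hWfin]
    exact (ENNReal.toReal_lt_toReal hWne ENNReal.one_ne_top).2 hW
  have havg := hs.tendsto_average _ hWint
  have hini : Tendsto (fun z : ℕ × Ω =>
      (∑ t ∈ Finset.Icc 1 p, (L (θhat z) (s t z.2) - L θstar (s t z.2))) / z.1)
      (probFilter μ) (𝓝 0) :=
    hs.tendsto_initial (g := fun θ x => L θ x - L θstar x) hΘ
      (fun x => (hc x).sub continuousOn_const) (fun θ hθ => (hm θ hθ).sub (hm _ hstar)) hmem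
  -- Only `T - p` summands carry the shift `-1`, while the averages divide by `T`; the discrepancy
  -- is `p / T`.
  have hp : Tendsto (fun z : ℕ × Ω => (p : ℝ) / z.1) (probFilter μ) (𝓝 0) :=
    (tendsto_const_div_atTop_nhds_zero_nat (p : ℝ)).comp tendsto_fst_probFilter
  have hsum := (hini.add (havg.sub_const 1)).add hp
  have hneg : 0 + (∫ x, (W x).toReal ∂P - 1) + 0 < 0 := by linarith
  filter_upwards [hsum.eventually_lt_const hneg, eventually_le_fst (max p 1), hmax,
    eventually_probFilter_of_ae (μ := μ) (q := fun z => ∀ t, p < t → W (s t z.2) < ⊤)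
      fun _ => hs.ae_of_ae hWfin] with z h1 h2 h3 h4 hz
  have hzp : p ≤ z.1 := le_trans (le_max_left _ _) h2
  have hz1 : (0 : ℝ) < z.1 := by exact_mod_cast le_trans (le_max_right p 1) h2
  -- If the maximizer lay in the ball, each likelihood ratio would be at most `W - 1`. Since this
  -- has negative mean, the total would eventually be negative, against maximality.
  have h5 : ∑ t ∈ Finset.Ioc p z.1, (L (θhat z) (s t z.2) - L θstar (s t z.2))
      ≤ ∑ t ∈ Finset.Ioc p z.1, ((W (s t z.2)).toReal - 1) := by
    refine Finset.sum_le_sum fun t ht => ?_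
    have ht' := h4 t (Finset.mem_Ioc.1 ht).1
    have h6 : f (θhat z) (s t z.2) ≤ W (s t z.2) :=
      le_iSup₂ (f := fun (η : E) (_ : η ∈ Θ ∩ Metric.ball θ₀ δ) => f η (s t z.2)) (θhat z) hz
    have h7 := (ENNReal.ofReal_le_iff_le_toReal ht'.ne).1 h6
    linarith
  have h6 : 0 ≤ ∑ t ∈ Finset.Icc 1 z.1, (L (θhat z) (s t z.2) - L θstar (s t z.2)) := by
    rw [Finset.sum_sub_distrib]; linarith
  rw [Finset.sum_Icc_one_eq_add hzp] at h6
  rw [Finset.sum_sub_distrib (f := fun t => (W (s t z.2)).toReal)] at h5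
  simp only [Finset.sum_const, Nat.card_Ioc, nsmul_eq_mul, mul_one, Nat.cast_sub hzp] at h5
  refine absurd h1 (not_lt.2 ?_)
  have h7 : (∑ t ∈ Finset.Icc 1 p, (L (θhat z) (s t z.2) - L θstar (s t z.2))) / (z.1 : ℝ)
      + ((∑ t ∈ Finset.Ioc p z.1, (W (s t z.2)).toReal) / (z.1 : ℝ) - 1) + (p : ℝ) / z.1
      = (∑ t ∈ Finset.Icc 1 p, (L (θhat z) (s t z.2) - L θstar (s t z.2))
        + (∑ t ∈ Finset.Ioc p z.1, (W (s t z.2)).toReal - (z.1 - p))) / z.1 := by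
    field_simp
    ring
  rw [h7]
  exact div_nonneg (by linarith) hz1.le

/-- Consistency of maximum likelihood estimators. -/
theorem tendsto_of_isMaximizer [IsProbabilityMeasure μ] (hs : WeakLawObs μ p s P)
    (hΘ : IsCompact Θ) (hc : ∀ x, ContinuousOn (fun θ => L θ x) Θ)
    (hm : ∀ θ ∈ Θ, Measurable (L θ)) (hstar : θstar ∈ Θ)
    (hB : ∫⁻ x, ⨆ θ ∈ Θ, ENNReal.ofReal (L θ x) ∂P < ⊤) (hint : Integrable (L θstar) P)
    (hmem : ∀ᶠ z in probFilter μ, θhat z ∈ Θ)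
    (hmax : ∀ᶠ z in probFilter μ, ∑ t ∈ Finset.Icc 1 z.1, L θstar (s t z.2)
      ≤ ∑ t ∈ Finset.Icc 1 z.1, L (θhat z) (s t z.2))
    (hid : ∀ θ ∈ Θ, θ ≠ θstar → ∫⁻ x, ENNReal.ofReal (L θ x - L θstar x + 1) ∂P < 1) :
    Tendsto θhat (probFilter μ) (𝓝 θstar) := by
  rw [Metric.tendsto_nhds]
  intro ε hε
  have hK : IsCompact (Θ \ Metric.ball θstar ε) := hΘ.diff Metric.isOpen_ball
  have hev : ∀ᶠ z in probFilter μ, θhat z ∉ Θ \ Metric.ball θstar ε := by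
    -- Finitely many of the balls excluded by `exists_eventually_notMem_ball` cover the part of `Θ`
    -- away from `θstar`.
    refine hK.induction_on (p := fun A => ∀ᶠ z in probFilter μ, θhat z ∉ A) (by simp)
      (fun A B hAB hB => hB.mono fun z hz hzA => hz (hAB hzA))
      (fun A B hA hB => by filter_upwards [hA, hB] with z h1 h2 h3 using h3.elim h1 h2) ?_
    intro θ hθ
    have hne : θ ≠ θstar := fun h => hθ.2 (h ▸ Metric.mem_ball_self hε)
    obtain ⟨δ, hδ, h⟩ := hs.exists_eventually_notMem_ball hΘ hc hm hstar hB hint hmem hmax hθ.1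
      (hid θ hθ.1 hne)
    refine ⟨Θ ∩ Metric.ball θ δ, ?_, h⟩
    exact inter_mem (mem_of_superset self_mem_nhdsWithin Set.sdiff_subset)
      (mem_nhdsWithin_of_mem_nhds (Metric.ball_mem_nhds θ hδ))
  filter_upwards [hev, hmem] with z h1 h2
  by_contra h
  exact h1 ⟨h2, h⟩

end Consistency

end WeakLawObs

/-! ### Moment bounds: martingale differences, and sums of squares under a first moment. -/

section Martingale

variable {Ω : Type*} [mΩ : MeasurableSpace Ω] {μ : Measure Ω} [IsFiniteMeasure μ]

/-- The variance of a sum of martingale differences. -/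
lemma integral_sq_sum_of_martingaleDifference {ℱ : Filtration ℕ mΩ} {p : ℕ} {ξ : ℕ → Ω → ℝ}
    {c : ℝ} (hadp : ∀ t, p < t → StronglyMeasurable[ℱ t] (ξ t))
    (hmem : ∀ t, p < t → MemLp (ξ t) 2 μ)
    (hce : ∀ t, p < t → μ[ξ t | ℱ (t - 1)] =ᵐ[μ] 0)
    (hc : ∀ t, p < t → ∫ ω, ξ t ω ^ 2 ∂μ = c) (n : ℕ) :
    ∫ ω, (∑ t ∈ Finset.Ioc p (p + n), ξ t ω) ^ 2 ∂μ = n * c := by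
  induction n with
  | zero => simp
  | succ n ih =>
    set M : Ω → ℝ := fun ω => ∑ t ∈ Finset.Ioc p (p + n), ξ t ω with hM
    have hMadp : StronglyMeasurable[ℱ (p + n)] M :=
      Finset.stronglyMeasurable_fun_sum _ fun t ht =>
        (hadp t (Finset.mem_Ioc.1 ht).1).mono (ℱ.mono (Finset.mem_Ioc.1 ht).2)
    have hMmem : MemLp M 2 μ := memLp_finsetSum _ fun t ht => hmem t (Finset.mem_Ioc.1 ht).1
    have hξ := hmem (p + n + 1) (by omega)
    have hprod : Integrable (M * ξ (p + n + 1)) μ := hMmem.integrable_mul hξ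
    -- The past sum is known at time `p + n`, so conditioning pulls it out and leaves the
    -- conditional mean of the next difference, which is zero.
    have hcross : ∫ ω, (M * ξ (p + n + 1)) ω ∂μ = 0 := by
      rw [← integral_condExp (ℱ.le (p + n))]
      have h1 := condExp_mul_of_stronglyMeasurable_left hMadp hprod
        (hξ.integrable (by norm_num))
      have h2 := hce (p + n + 1) (by omega)
      rw [Nat.add_sub_cancel] at h2
      rw [integral_congr_ae (g := fun _ => (0 : ℝ)), integral_zero]
      filter_upwards [h1, h2] with ω h1 h2
      rw [h1, Pi.mul_apply, h2, Pi.zero_apply, mul_zero]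
    have hsplit (ω : Ω) : (∑ t ∈ Finset.Ioc p (p + (n + 1)), ξ t ω) ^ 2
        = M ω ^ 2 + 2 * (M * ξ (p + n + 1)) ω + ξ (p + n + 1) ω ^ 2 := by
      rw [← add_assoc, Finset.sum_Ioc_succ_top (by omega)]
      simp only [hM, Pi.mul_apply]
      ring
    simp only [hsplit]
    rw [integral_add (f := fun ω => M ω ^ 2 + 2 * (M * ξ (p + n + 1)) ω)
      (hMmem.integrable_sq.add (hprod.const_mul 2)) hξ.integrable_sq,
      integral_add hMmem.integrable_sq (hprod.const_mul 2), integral_const_mul, hcross, ih,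
      hc _ (by omega)]
    push_cast
    ring

end Martingale

namespace WeakLawObs

variable {Ω S : Type*} [MeasurableSpace Ω] [MeasurableSpace S] {μ : Measure Ω}
  {p : ℕ} {s : ℕ → Ω → S} {P : Measure S}

/-- The sum of squares of integrable stationary variables is of smaller order than the squared
sample size. -/
lemma tendsto_sum_sq_div_sq (hs : WeakLawObs μ p s P) {w : S → ℝ} (hwm : Measurable w)
    (hw0 : ∀ x, 0 ≤ w x) (hw : Integrable w P) :
    Tendsto (fun z : ℕ × Ω => (∑ t ∈ Finset.Ioc p z.1, w (s t z.2) ^ 2) / (z.1 : ℝ) ^ 2)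
      (probFilter μ) (𝓝 0) := by
  -- Truncation makes a first moment suffice: `min (a²) 1 ≤ a` gives `T * F T ≤ w`, and `T * F T ≤
  -- w² / T` tends to zero pointwise, so `T * E (F T)` tends to zero by dominated convergence.
  set F : ℕ → S → ℝ := fun T x => min (w x ^ 2 / (T : ℝ) ^ 2) 1 with hF
  have hF0 (T x) : 0 ≤ F T x := le_min (by positivity) zero_le_one
  have hFm (T) : Measurable (F T) := ((hwm.pow_const 2).div_const _).min measurable_const
  have hlim : Tendsto (fun T : ℕ => ∫⁻ x, ENNReal.ofReal (T * F T x) ∂P) atTop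
      (𝓝 (∫⁻ _, 0 ∂P)) := by
    refine tendsto_lintegral_of_dominated_convergence (fun x => ENNReal.ofReal (w x))
      (fun T => ((hFm T).const_mul _).ennreal_ofReal) (fun T => ae_of_all _ fun x => ?_) ?_
      (ae_of_all _ fun x => ?_)
    · refine ENNReal.ofReal_le_ofReal ?_
      rcases Nat.eq_zero_or_pos T with rfl | hT
      · simpa using hw0 x
      have hT' : (0 : ℝ) < T := by exact_mod_cast hT
      have h1 : F T x ≤ w x / T := by
        rcases le_total (w x / T) 1 with h | h
        · refine (min_le_left _ _).trans ?_
          rw [← div_pow]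
          exact pow_le_of_le_one (div_nonneg (hw0 x) hT'.le) h two_ne_zero
        · exact (min_le_right _ _).trans h
      calc (T : ℝ) * F T x ≤ T * (w x / T) := by gcongr
        _ = w x := by field_simp
    · have := hw.2
      rw [hasFiniteIntegral_iff_ofReal (ae_of_all _ hw0)] at this
      exact this.ne
    · rw [← ENNReal.ofReal_zero]
      refine ENNReal.tendsto_ofReal (squeeze_zero (fun T => mul_nonneg T.cast_nonneg (hF0 T x))
        (fun T => ?_) (tendsto_const_div_atTop_nhds_zero_nat (w x ^ 2)))
      rcases Nat.eq_zero_or_pos T with rfl | hT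
      · simp
      have hT' : (0 : ℝ) < T := by exact_mod_cast hT
      calc (T : ℝ) * F T x ≤ T * (w x ^ 2 / (T : ℝ) ^ 2) := by gcongr; exact min_le_left _ _
        _ = w x ^ 2 / T := by field_simp
  rw [lintegral_zero] at hlim
  rw [Metric.tendsto_nhds]
  intro ε hε
  rw [eventually_probFilter]
  have hε' : 0 < min ε 1 := lt_min hε one_pos
  have hlim' : Tendsto (fun T : ℕ => (∫⁻ x, ENNReal.ofReal (T * F T x) ∂P)
      / ENNReal.ofReal (min ε 1)) atTop (𝓝 0) := by
    have := ENNReal.Tendsto.div_const hlim (b := ENNReal.ofReal (min ε 1))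
      (Or.inr (by simpa using hε'))
    simpa using this
  refine tendsto_of_tendsto_of_tendsto_of_le_of_le tendsto_const_nhds hlim'
    (fun _ => zero_le) fun T => ?_
  have hmeas (t) (ht : t ∈ Finset.Ioc p T) :
      Measurable fun ω => ENNReal.ofReal (F T (s t ω)) :=
    ((hFm T).comp (hs.measurable t (by have := Finset.mem_Ioc.1 ht; omega))).ennreal_ofReal
  -- Either some summand reaches `1`, and then so does the truncated sum, or truncation changes
  -- nothing. Hence the threshold `min ε 1`.
  have hsub : {ω | ¬ dist ((∑ t ∈ Finset.Ioc p T, w (s t ω) ^ 2) / (T : ℝ) ^ 2) 0 < ε}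
      ⊆ {ω | ENNReal.ofReal (min ε 1) ≤ ∑ t ∈ Finset.Ioc p T, ENNReal.ofReal (F T (s t ω))} := by
    intro ω h
    simp only [Set.mem_ofPred_eq, not_lt, dist_zero_right, Real.norm_eq_abs] at h ⊢
    rw [abs_of_nonneg (by positivity)] at h
    rw [← ENNReal.ofReal_sum_of_nonneg fun t _ => hF0 _ _]
    refine ENNReal.ofReal_le_ofReal ?_
    by_cases hbig : ∃ t ∈ Finset.Ioc p T, 1 ≤ w (s t ω) ^ 2 / (T : ℝ) ^ 2
    · obtain ⟨t, ht, h1⟩ := hbig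
      calc min ε 1 ≤ 1 := min_le_right _ _
        _ = F T (s t ω) := (min_eq_right h1).symm
        _ ≤ _ := Finset.single_le_sum (f := fun t => F T (s t ω)) (fun t _ => hF0 _ _) ht
    · push Not at hbig
      refine (min_le_left _ _).trans (h.trans (le_of_eq ?_))
      rw [Finset.sum_div]
      exact Finset.sum_congr rfl fun t ht => (min_eq_left (hbig t ht).le).symm
  calc _ ≤ _ := measure_mono hsub
    _ ≤ _ := meas_ge_le_lintegral_div (Finset.aemeasurable_fun_sum _ fun t ht =>
        (hmeas t ht).aemeasurable) (by simpa using hε') ENNReal.ofReal_ne_top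
    _ ≤ _ := by
      gcongr
      rw [lintegral_finsetSum' _ fun t ht => (hmeas t ht).aemeasurable]
      have (t) (ht : t ∈ Finset.Ioc p T) : ∫⁻ ω, ENNReal.ofReal (F T (s t ω)) ∂μ
          = ∫⁻ x, ENNReal.ofReal (F T x) ∂P := by
        have h1 := Finset.mem_Ioc.1 ht
        rw [← hs.map_eq t h1.1, lintegral_map (hFm T).ennreal_ofReal (hs.measurable t (by omega))]
      rw [Finset.sum_congr rfl this, Finset.sum_const, Nat.card_Ioc, nsmul_eq_mul]
      simp only [ENNReal.ofReal_mul (Nat.cast_nonneg T), ENNReal.ofReal_natCast]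
      rw [lintegral_const_mul _ (hFm T).ennreal_ofReal]
      gcongr
      exact Nat.sub_le _ _

end WeakLawObs

/-! ### Coordinates in the parameter space and the local expansion of the score. -/

namespace ATM

variable {v : ℕ}

lemma abs_apply_le_norm (u : Param v) (i : Fin v) : |u i| ≤ ‖u‖ := by
  simpa using PiLp.norm_apply_le u i

lemma eq_sum_smul_basisVec (u : Param v) : u = ∑ i, u i • basisVec i := by
  ext k
  simp [basisVec, Pi.single_apply]

lemma clm_apply_eq_sum (A : Param v →L[ℝ] ℝ) (u : Param v) :
    A u = ∑ i, u i * A (basisVec i) := by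
  conv_lhs => rw [eq_sum_smul_basisVec u]
  simp

lemma norm_clm_le_sum (A : Param v →L[ℝ] ℝ) : ‖A‖ ≤ ∑ i, |A (basisVec i)| := by
  refine A.opNorm_le_bound (Finset.sum_nonneg fun _ _ => abs_nonneg _) fun u => ?_
  rw [clm_apply_eq_sum A u, Finset.sum_mul]
  refine (norm_sum_le _ _).trans (Finset.sum_le_sum fun i _ => ?_)
  rw [norm_mul, mul_comm]
  gcongr
  · exact le_rfl
  · exact abs_apply_le_norm u i

lemma norm_param_le_sum (u : Param v) : ‖u‖ ≤ ∑ i, |u i| := by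
  conv_lhs => rw [eq_sum_smul_basisVec u]
  refine (norm_sum_le _ _).trans (Finset.sum_le_sum fun i _ => ?_)
  rw [norm_smul, basisVec, EuclideanSpace.single, PiLp.norm_single]
  simp

/-- A nonsingular matrix is bounded below. -/
lemma exists_norm_le_sum_abs_vecMul {A : Matrix (Fin v) (Fin v) ℝ} (hA : IsUnit A.det) :
    ∃ c > 0, ∀ u : Param v, ‖u‖ ≤ c * ∑ j, |∑ i, u i * A i j| := by
  -- The entries of the inverse bound `u` by its image; the `+ 1` keeps the constant positive also
  -- for `v = 0`.
  refine ⟨∑ k, ∑ j, |A⁻¹ j k| + 1,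
    add_pos_of_nonneg_of_pos (Finset.sum_nonneg fun _ _ => Finset.sum_nonneg fun _ _ =>
      abs_nonneg _) one_pos, fun u => ?_⟩
  set y : Fin v → ℝ := fun j => ∑ i, u i * A i j with hy
  have hu (k : Fin v) : u k = ∑ j, y j * A⁻¹ j k := by
    have h1 : Matrix.vecMul (Matrix.vecMul (fun i => u i) A) A⁻¹ = fun i => u i := by
      rw [Matrix.vecMul_vecMul, Matrix.mul_nonsing_inv _ hA, Matrix.vecMul_one]
    have h2 := congrFun h1 k
    simpa [Matrix.vecMul, dotProduct, hy] using h2.symm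
  have hS : 0 ≤ ∑ j, |y j| := Finset.sum_nonneg fun _ _ => abs_nonneg _
  calc ‖u‖ ≤ ∑ k, |u k| := norm_param_le_sum u
    _ ≤ ∑ k, ∑ j, |A⁻¹ j k| * ∑ j, |y j| := by
      refine Finset.sum_le_sum fun k _ => ?_
      rw [hu k]
      refine (Finset.abs_sum_le_sum_abs _ _).trans (Finset.sum_le_sum fun j _ => ?_)
      rw [abs_mul, mul_comm]
      gcongr
      exact Finset.single_le_sum (f := fun j => |y j|) (fun _ _ => abs_nonneg _)
        (Finset.mem_univ j)
    _ = (∑ k, ∑ j, |A⁻¹ j k|) * ∑ j, |y j| := by simp only [Finset.sum_mul]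
    _ ≤ _ := by gcongr; linarith

variable {S : Type*} [MeasurableSpace S]

/-- Near `θstar` the score `sc` is differentiable with the derivative `-H`, and `H` is continuous
and dominated by an integrable function. -/
structure LocalScore (P : Measure S) (θstar : Param v) (ρ : ℝ) (sc : Fin v → Param v → S → ℝ)
    (H : Fin v → Fin v → Param v → S → ℝ) : Prop where
  pos : 0 < ρ
  differentiableAt : ∀ j x, ∀ θ ∈ Metric.ball θstar ρ, DifferentiableAt ℝ (fun η => sc j η x) θ
  fderiv_eq : ∀ i j x, ∀ θ ∈ Metric.ball θstar ρ,
    fderiv ℝ (fun η => sc j η x) θ (basisVec i) = -H i j θ x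
  measurable_sc : ∀ j, ∀ θ ∈ Metric.ball θstar ρ, Measurable (sc j θ)
  continuousOn_H : ∀ i j x, ContinuousOn (fun θ => H i j θ x) (Metric.ball θstar ρ)
  measurable_H : ∀ i j, ∀ θ ∈ Metric.ball θstar ρ, Measurable (H i j θ)
  lintegral_lt_top :
    ∫⁻ x, ⨆ θ ∈ Metric.ball θstar ρ, ENNReal.ofReal (∑ i, ∑ j, |H i j θ x|) ∂P < ⊤

namespace LocalScore

variable {P : Measure S} {θstar : Param v} {ρ : ℝ} {sc : Fin v → Param v → S → ℝ}
  {H : Fin v → Fin v → Param v → S → ℝ}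

lemma mem_ball (h : LocalScore P θstar ρ sc H) : θstar ∈ Metric.ball θstar ρ :=
  Metric.mem_ball_self h.pos

lemma continuousOn_sc (h : LocalScore P θstar ρ sc H) (j : Fin v) (x : S) :
    ContinuousOn (fun θ => sc j θ x) (Metric.ball θstar ρ) := fun θ hθ =>
  (h.differentiableAt j x θ hθ).continuousAt.continuousWithinAt

/-- An integrable envelope of the Hessian. -/
lemma exists_envelope (h : LocalScore P θstar ρ sc H) :
    ∃ w : S → ℝ, Measurable w ∧ (∀ x, 0 ≤ w x) ∧ Integrable w P ∧
      ∀ᵐ x ∂P, ∀ θ ∈ Metric.ball θstar ρ, ∑ i, ∑ j, |H i j θ x| ≤ w x := by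
  set W : S → ℝ≥0∞ := fun x => ⨆ θ ∈ Metric.ball θstar ρ, ENNReal.ofReal (∑ i, ∑ j, |H i j θ x|)
    with hW
  have hWm : Measurable W := measurable_biSup_of_continuousOn
    (fun x => ENNReal.continuous_ofReal.comp_continuousOn (continuousOn_finsetSum _ fun i _ =>
      continuousOn_finsetSum _ fun j _ => (h.continuousOn_H i j x).abs))
    fun θ hθ => (Finset.measurable_sum _ fun i _ => Finset.measurable_sum _ fun j _ =>
      (h.measurable_H i j θ hθ).abs).ennreal_ofReal
  refine ⟨fun x => (W x).toReal, hWm.ennreal_toReal, fun x => ENNReal.toReal_nonneg,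
    integrable_toReal_of_lintegral_ne_top hWm.aemeasurable h.lintegral_lt_top.ne, ?_⟩
  filter_upwards [ae_lt_top hWm h.lintegral_lt_top.ne] with x hx θ hθ
  exact (ENNReal.ofReal_le_iff_le_toReal hx.ne).1 (le_iSup₂
    (f := fun (η : Param v) (_ : η ∈ Metric.ball θstar ρ) =>
      ENNReal.ofReal (∑ i, ∑ j, |H i j η x|)) θ hθ)

/-- The oscillation of the Hessian near `θstar` has an envelope with a small integral. -/
lemma exists_oscillation_envelope (h : LocalScore P θstar ρ sc H) {η : ℝ} (hη : 0 < η) :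
    ∃ δ > 0, δ ≤ ρ ∧ ∃ w : S → ℝ, (∀ x, 0 ≤ w x) ∧ Integrable w P ∧ ∫ x, w x ∂P < η ∧
      ∀ᵐ x ∂P, ∀ θ ∈ Metric.ball θstar δ, ∑ i, ∑ j, |H i j θ x - H i j θstar x| ≤ w x := by
  set f : Param v → S → ℝ≥0∞ := fun θ x => ENNReal.ofReal (∑ i, ∑ j, |H i j θ x - H i j θstar x|)
    with hf
  have hfc (x : S) : ContinuousOn (fun θ => f θ x) (Metric.ball θstar ρ) :=
    ENNReal.continuous_ofReal.comp_continuousOn (continuousOn_finsetSum _ fun i _ =>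
      continuousOn_finsetSum _ fun j _ => ((h.continuousOn_H i j x).sub continuousOn_const).abs)
  have hfm (θ : Param v) (hθ : θ ∈ Metric.ball θstar ρ) : Measurable (f θ) :=
    (Finset.measurable_sum _ fun i _ => Finset.measurable_sum _ fun j _ =>
      ((h.measurable_H i j θ hθ).sub (h.measurable_H i j θstar h.mem_ball)).abs).ennreal_ofReal
  set B : S → ℝ≥0∞ := fun x => 2 * ⨆ θ ∈ Metric.ball θstar ρ,
    ENNReal.ofReal (∑ i, ∑ j, |H i j θ x|) with hB
  have hBne : ∫⁻ x, B x ∂P ≠ ⊤ := by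
    rw [lintegral_const_mul' _ _ (by simp)]
    exact ENNReal.mul_ne_top (by simp) h.lintegral_lt_top.ne
  have hfB (θ) (hθ : θ ∈ Metric.ball θstar ρ) (x : S) : f θ x ≤ B x := by
    have hle (θ) (hθ : θ ∈ Metric.ball θstar ρ) := le_iSup₂
      (f := fun (η : Param v) (_ : η ∈ Metric.ball θstar ρ) =>
        ENNReal.ofReal (∑ i, ∑ j, |H i j η x|)) θ hθ
    calc f θ x ≤ ENNReal.ofReal (∑ i, ∑ j, |H i j θ x| + ∑ i, ∑ j, |H i j θstar x|) := by
          refine ENNReal.ofReal_le_ofReal ?_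
          simp only [← Finset.sum_add_distrib]
          exact Finset.sum_le_sum fun i _ => Finset.sum_le_sum fun j _ => abs_sub _ _
      _ ≤ _ := ENNReal.ofReal_add_le
      _ ≤ B x := by
        simp only [hB, two_mul]
        exact add_le_add (hle θ hθ) (hle θstar h.mem_ball)
  -- The oscillation vanishes at the centre, so its supremum over a small enough ball has mean below
  -- `η`.
  have h0 : ∫⁻ x, f θstar x ∂P < ENNReal.ofReal η := by simpa [hf] using hη
  obtain ⟨δ, hδ, hlt⟩ := exists_lintegral_biSup_inter_ball_lt h.mem_ball hfc hfm hBne hfB h0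
  set W : S → ℝ≥0∞ := fun x => ⨆ θ ∈ Metric.ball θstar ρ ∩ Metric.ball θstar δ, f θ x with hW
  have hWm : Measurable W := measurable_biSup_of_continuousOn
    (fun x => (hfc x).mono Set.inter_subset_left) fun θ hθ => hfm θ hθ.1
  have hWne : ∫⁻ x, W x ∂P ≠ ⊤ := (hlt.trans ENNReal.ofReal_lt_top).ne
  have hWfin := ae_lt_top hWm hWne
  refine ⟨min δ ρ, lt_min hδ h.pos, min_le_right _ _, fun x => (W x).toReal,
    fun x => ENNReal.toReal_nonneg,
    integrable_toReal_of_lintegral_ne_top hWm.aemeasurable hWne, ?_, ?_⟩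
  · rw [integral_toReal hWm.aemeasurable hWfin]
    exact (ENNReal.lt_ofReal_iff_toReal_lt hWne).1 hlt
  · filter_upwards [hWfin] with x hx θ hθ
    refine (ENNReal.ofReal_le_iff_le_toReal hx.ne).1 (le_iSup₂
      (f := fun (η : Param v) (_ : η ∈ Metric.ball θstar ρ ∩ Metric.ball θstar δ) => f η x) θ
      ⟨?_, ?_⟩)
    · exact Metric.ball_subset_ball (min_le_right _ _) hθ
    · exact Metric.ball_subset_ball (min_le_left _ _) hθ

lemma integrable_H (h : LocalScore P θstar ρ sc H) (i j : Fin v) :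
    Integrable (H i j θstar) P := by
  obtain ⟨w, -, -, hw, hle⟩ := h.exists_envelope
  refine hw.mono' (h.measurable_H i j θstar h.mem_ball).aestronglyMeasurable ?_
  filter_upwards [hle] with x hx
  refine le_trans ?_ (hx θstar h.mem_ball)
  refine le_trans ?_ (Finset.single_le_sum (f := fun i => ∑ j, |H i j θstar x|)
    (fun _ _ => Finset.sum_nonneg fun _ _ => abs_nonneg _) (Finset.mem_univ i))
  exact Finset.single_le_sum (f := fun j => |H i j θstar x|) (fun _ _ => abs_nonneg _)
    (Finset.mem_univ j)

/-- First-order expansion of the score. -/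
lemma abs_sc_sub_add_le (h : LocalScore P θstar ρ sc H) {δ : ℝ} (hδρ : δ ≤ ρ) {x : S} {c : ℝ}
    (hc : ∀ θ ∈ Metric.ball θstar δ, ∑ i, ∑ j, |H i j θ x - H i j θstar x| ≤ c)
    {θ : Param v} (hθ : θ ∈ Metric.ball θstar δ) (j : Fin v) :
    |sc j θ x - sc j θstar x + ∑ i, (θ - θstar) i * H i j θstar x| ≤ c * ‖θ - θstar‖ := by
  have hδ : 0 < δ := dist_nonneg.trans_lt hθ
  have hsub := Metric.ball_subset_ball (x := θstar) hδρ
  -- Mean value inequality for the score minus its linearization at `θstar`; the derivative of this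
  -- difference is minus the oscillation of `H`.
  have key := (convex_ball θstar δ).norm_image_sub_le_of_norm_hasFDerivWithin_le'
    (f := fun η => sc j η x) (φ := fderiv ℝ (fun η => sc j η x) θstar) (C := c)
    (fun η hη => (h.differentiableAt j x η (hsub hη)).hasFDerivAt.hasFDerivWithinAt)
    (fun η hη => by
      refine (norm_clm_le_sum _).trans (le_trans (Finset.sum_le_sum fun i _ => ?_) (hc η hη))
      rw [sub_apply, h.fderiv_eq i j x η (hsub hη),
        h.fderiv_eq i j x θstar h.mem_ball, ← abs_neg, neg_sub, sub_neg_eq_add,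
        neg_add_eq_sub]
      exact Finset.single_le_sum (f := fun j => |H i j η x - H i j θstar x|)
        (fun _ _ => abs_nonneg _) (Finset.mem_univ j))
    (Metric.mem_ball_self hδ) hθ
  rw [clm_apply_eq_sum] at key
  simp only [h.fderiv_eq _ j x θstar h.mem_ball, mul_neg, Finset.sum_neg_distrib,
    sub_neg_eq_add] at key
  exact key

/-- Lipschitz continuity of the score. -/
lemma abs_sc_sub_le (h : LocalScore P θstar ρ sc H) {x : S} {c : ℝ}
    (hc : ∀ θ ∈ Metric.ball θstar ρ, ∑ i, ∑ j, |H i j θ x| ≤ c)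
    {θ : Param v} (hθ : θ ∈ Metric.ball θstar ρ) (j : Fin v) :
    |sc j θ x - sc j θstar x| ≤ c * ‖θ - θstar‖ := by
  refine (convex_ball θstar ρ).norm_image_sub_le_of_norm_hasFDerivWithin_le
    (f := fun η => sc j η x) (C := c)
    (fun η hη => (h.differentiableAt j x η hη).hasFDerivAt.hasFDerivWithinAt)
    (fun η hη => ?_) h.mem_ball hθ
  refine (norm_clm_le_sum _).trans (le_trans (Finset.sum_le_sum fun i _ => ?_) (hc η hη))
  rw [h.fderiv_eq i j x η hη, abs_neg]
  exact Finset.single_le_sum (f := fun j => |H i j η x|)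
    (fun _ _ => abs_nonneg _) (Finset.mem_univ j)

end LocalScore

end ATM

/-! ### Averages at a consistent estimator: the Hessian, the rate of the estimator, the outer
product. -/

namespace ATM

/-- Cauchy–Schwarz for averages in probability. -/
lemma tendsto_average_mul_of_tendsto_average_sq {α : Type*} {l : Filter α} {I : α → Finset ℕ}
    {n : α → ℝ} {a b : α → ℕ → ℝ} {c : ℝ}
    (ha : Tendsto (fun z => (∑ t ∈ I z, a z t ^ 2) / n z) l (𝓝 0))
    (hb : Tendsto (fun z => (∑ t ∈ I z, b z t ^ 2) / n z) l (𝓝 c)) :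
    Tendsto (fun z => (∑ t ∈ I z, a z t * b z t) / n z) l (𝓝 0) := by
  have h := (ha.mul hb).sqrt
  rw [zero_mul, Real.sqrt_zero] at h
  refine squeeze_zero_norm (fun z => Real.le_sqrt_of_sq_le ?_) h
  rw [Real.norm_eq_abs, sq_abs, div_pow, div_mul_div_comm, ← sq]
  gcongr
  exact Finset.sum_mul_sq_le_sq_mul_sq _ _ _

variable {v p : ℕ} {Ω S : Type*} [MeasurableSpace Ω] [MeasurableSpace S] {μ : Measure Ω}
  {s : ℕ → Ω → S} {P : Measure S} {θstar : Param v} {ρ : ℝ} {sc : Fin v → Param v → S → ℝ}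
  {H : Fin v → Fin v → Param v → S → ℝ} {θhat : ℕ × Ω → Param v}

namespace LocalScore

lemma eventually_mem_ball (hθ : Tendsto θhat (probFilter μ) (𝓝 θstar)) {δ : ℝ} (hδ : 0 < δ) :
    ∀ᶠ z in probFilter μ, θhat z ∈ Metric.ball θstar δ :=
  hθ.eventually (Metric.ball_mem_nhds _ hδ)

lemma eventually_mem_closedBall (hθ : Tendsto θhat (probFilter μ) (𝓝 θstar)) {δ : ℝ}
    (hδ : 0 < δ) : ∀ᶠ z in probFilter μ, θhat z ∈ Metric.closedBall θstar δ :=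
  hθ.eventually (Metric.closedBall_mem_nhds _ hδ)

lemma closedBall_half_subset (h : LocalScore P θstar ρ sc H) :
    Metric.closedBall θstar (ρ / 2) ⊆ Metric.ball θstar ρ :=
  Metric.closedBall_subset_ball (by linarith [h.pos])

/-- The average Hessian at a consistent estimator. -/
theorem tendsto_average_H [IsFiniteMeasure μ] (h : LocalScore P θstar ρ sc H)
    (hs : WeakLawObs μ p s P) (hθ : Tendsto θhat (probFilter μ) (𝓝 θstar)) (i j : Fin v) :
    Tendsto (fun z : ℕ × Ω => (∑ t ∈ Finset.Icc 1 z.1, H i j (θhat z) (s t z.2)) / z.1)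
      (probFilter μ) (𝓝 (∫ x, H i j θstar x ∂P)) := by
  refine hs.tendsto_full_average (isCompact_closedBall θstar (ρ / 2))
    (fun x => (h.continuousOn_H i j x).mono h.closedBall_half_subset)
    (fun θ hθ => h.measurable_H i j θ (h.closedBall_half_subset hθ))
    (eventually_mem_closedBall hθ (half_pos h.pos)) ?_
  rw [Metric.tendsto_nhds]
  intro ε hε
  -- Passing from the estimator to `θstar` costs at most the average of `w`, eventually below `ε /
  -- 2`; the other half is the weak law at `θstar`.
  obtain ⟨δ, hδ, hδρ, w, hw0, hw, hwlt, hle⟩ := h.exists_oscillation_envelope (half_pos hε)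
  filter_upwards [(hs.tendsto_average w hw).eventually_lt_const hwlt,
    (Metric.tendsto_nhds.1 (hs.tendsto_average _ (h.integrable_H i j))) (ε / 2) (half_pos hε),
    eventually_mem_ball hθ hδ, eventually_probFilter_of_ae (μ := μ)
      (q := fun z => ∀ t, p < t → ∀ θ ∈ Metric.ball θstar δ,
        ∑ i, ∑ j, |H i j θ (s t z.2) - H i j θstar (s t z.2)| ≤ w (s t z.2))
      fun _ => hs.ae_of_ae hle] with z h1 h2 h3 h4
  have h5 : |(∑ t ∈ Finset.Ioc p z.1, H i j (θhat z) (s t z.2)) / (z.1 : ℝ)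
      - (∑ t ∈ Finset.Ioc p z.1, H i j θstar (s t z.2)) / (z.1 : ℝ)|
      ≤ (∑ t ∈ Finset.Ioc p z.1, w (s t z.2)) / z.1 := by
    rw [← sub_div, ← Finset.sum_sub_distrib, abs_div, Nat.abs_cast]
    gcongr
    refine (Finset.abs_sum_le_sum_abs _ _).trans (Finset.sum_le_sum fun t ht => ?_)
    refine le_trans ?_ (h4 t (Finset.mem_Ioc.1 ht).1 _ h3)
    refine le_trans ?_ (Finset.single_le_sum
      (f := fun i => ∑ j, |H i j (θhat z) (s t z.2) - H i j θstar (s t z.2)|)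
      (fun _ _ => Finset.sum_nonneg fun _ _ => abs_nonneg _) (Finset.mem_univ i))
    exact Finset.single_le_sum
      (f := fun j => |H i j (θhat z) (s t z.2) - H i j θstar (s t z.2)|)
      (fun _ _ => abs_nonneg _) (Finset.mem_univ j)
  rw [Real.dist_eq] at h2 ⊢
  rw [abs_lt] at h2 ⊢
  rw [abs_le] at h5
  constructor <;> linarith [h5.1, h5.2, h2.1, h2.2]

/-- The estimation error is bounded by the average score at the true value. -/
theorem exists_eventually_norm_sub_le [IsFiniteMeasure μ] (h : LocalScore P θstar ρ sc H)
    (hs : WeakLawObs μ p s P) (hθ : Tendsto θhat (probFilter μ) (𝓝 θstar))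
    (hdet : IsUnit (Matrix.of fun i j => ∫ x, H i j θstar x ∂P).det)
    (hfoc : ∀ᶠ z in probFilter μ, ∀ j, ∑ t ∈ Finset.Icc 1 z.1, sc j (θhat z) (s t z.2) = 0) :
    ∃ c > 0, ∀ᶠ z in probFilter μ, ‖θhat z - θstar‖ ≤ c * ∑ j,
      (|(∑ t ∈ Finset.Ioc p z.1, sc j θstar (s t z.2)) / (z.1 : ℝ)| +
        |(∑ t ∈ Finset.Icc 1 p, sc j (θhat z) (s t z.2)) / (z.1 : ℝ)|) := by
  obtain ⟨c, hc, hbound⟩ := exists_norm_le_sum_abs_vecMul hdet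
  simp only [Matrix.of_apply] at hbound
  -- Summed over the `v` columns, the oscillation stays below `1 / (2 * c)`, so that it can be
  -- absorbed; `v + 1` avoids dividing by zero.
  have hη : 0 < 1 / (2 * c * (v + 1)) := by positivity
  obtain ⟨δ, hδ, hδρ, w, hw0, hw, hwlt, hle⟩ := h.exists_oscillation_envelope hη
  refine ⟨2 * c, by positivity, ?_⟩
  have hlim : Tendsto (fun z : ℕ × Ω => ∑ j, (∑ i, |∫ x, H i j θstar x ∂P
      - (∑ t ∈ Finset.Ioc p z.1, H i j θstar (s t z.2)) / (z.1 : ℝ)|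
      + (∑ t ∈ Finset.Ioc p z.1, w (s t z.2)) / (z.1 : ℝ))) (probFilter μ)
      (𝓝 (∑ j : Fin v, (∑ i, |∫ x, H i j θstar x ∂P - ∫ x, H i j θstar x ∂P|
        + ∫ x, w x ∂P))) :=
    tendsto_finsetSum _ fun j _ => (tendsto_finsetSum _ fun i _ =>
      (tendsto_const_nhds.sub (hs.tendsto_average _ (h.integrable_H i j))).abs).add
        (hs.tendsto_average w hw)
  have hlt : ∑ j : Fin v, (∑ i, |∫ x, H i j θstar x ∂P - ∫ x, H i j θstar x ∂P|
        + ∫ x, w x ∂P) < 1 / (2 * c) := by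
    simp only [sub_self, abs_zero, Finset.sum_const_zero, zero_add, Finset.sum_const,
      Finset.card_univ, Fintype.card_fin, nsmul_eq_mul]
    have h0 : 0 ≤ ∫ x, w x ∂P := integral_nonneg hw0
    calc (v : ℝ) * ∫ x, w x ∂P ≤ (v + 1) * ∫ x, w x ∂P := by gcongr; linarith
      _ < (v + 1) * (1 / (2 * c * (v + 1))) := by gcongr
      _ = 1 / (2 * c) := by field_simp
  filter_upwards [hlim.eventually_lt_const hlt, hfoc, eventually_mem_ball hθ hδ,
    WeakLawObs.eventually_le_fst p, eventually_probFilter_of_ae (μ := μ)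
      (q := fun z => ∀ t, p < t → ∀ θ ∈ Metric.ball θstar δ,
        ∑ i, ∑ j, |H i j θ (s t z.2) - H i j θstar (s t z.2)| ≤ w (s t z.2))
      fun _ => hs.ae_of_ae hle] with z h1 h2 h3 hpz h4
  set u := θhat z - θstar with hu
  set T : ℝ := (z.1 : ℝ) with hT
  set Abar : Fin v → Fin v → ℝ := fun i j => (∑ t ∈ Finset.Ioc p z.1, H i j θstar (s t z.2)) / T
    with hA
  set wbar : ℝ := (∑ t ∈ Finset.Ioc p z.1, w (s t z.2)) / T with hwb
  set N : Fin v → ℝ := fun j => (∑ t ∈ Finset.Ioc p z.1, sc j θstar (s t z.2)) / T with hN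
  set b : Fin v → ℝ := fun j => (∑ t ∈ Finset.Icc 1 p, sc j (θhat z) (s t z.2)) / T with hb
  -- The score equation turns the later scores at the estimator into minus the first `p` ones, and
  -- the expansion at `θstar` is summed term by term.
  have hexp (j : Fin v) : |-b j - N j + ∑ i, u i * Abar i j| ≤ wbar * ‖u‖ := by
    have e1 : -b j = (∑ t ∈ Finset.Ioc p z.1, sc j (θhat z) (s t z.2)) / T := by
      have := h2 j
      rw [Finset.sum_Icc_one_eq_add hpz] at this
      rw [hb, ← neg_div]
      congr 1
      linarith
    have e2 : ∑ i, u i * Abar i j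
        = (∑ t ∈ Finset.Ioc p z.1, ∑ i, u i * H i j θstar (s t z.2)) / T := by
      rw [Finset.sum_comm, Finset.sum_div]
      refine Finset.sum_congr rfl fun i _ => ?_
      rw [hA, ← Finset.mul_sum, mul_div_assoc]
    rw [e1, e2, hN, hwb, ← sub_div, ← add_div, ← Finset.sum_sub_distrib, ← Finset.sum_add_distrib,
      abs_div, abs_of_nonneg (Nat.cast_nonneg z.1 : 0 ≤ T), div_mul_eq_mul_div, Finset.sum_mul]
    refine div_le_div_of_nonneg_right ?_ (Nat.cast_nonneg z.1)
    refine (Finset.abs_sum_le_sum_abs _ _).trans (Finset.sum_le_sum fun t ht => ?_)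
    exact h.abs_sc_sub_add_le hδρ (h4 t (Finset.mem_Ioc.1 ht).1) h3 j
  have hcol (j : Fin v) : |∑ i, u i * ∫ x, H i j θstar x ∂P|
      ≤ ‖u‖ * (∑ i, |∫ x, H i j θstar x ∂P - Abar i j| + wbar) + (|N j| + |b j|) := by
    have e1 : ∑ i, u i * ∫ x, H i j θstar x ∂P
        = ∑ i, u i * (∫ x, H i j θstar x ∂P - Abar i j)
          + (-b j - N j + ∑ i, u i * Abar i j) + N j + b j := by
      simp only [mul_sub, Finset.sum_sub_distrib]
      ring
    have e2 : |∑ i, u i * (∫ x, H i j θstar x ∂P - Abar i j)|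
        ≤ ‖u‖ * ∑ i, |∫ x, H i j θstar x ∂P - Abar i j| := by
      rw [Finset.mul_sum]
      refine (Finset.abs_sum_le_sum_abs _ _).trans (Finset.sum_le_sum fun i _ => ?_)
      rw [abs_mul]
      gcongr
      exact abs_apply_le_norm u i
    rw [e1]
    have t1 := abs_add_le (∑ i, u i * (∫ x, H i j θstar x ∂P - Abar i j)
      + (-b j - N j + ∑ i, u i * Abar i j) + N j) (b j)
    have t2 := abs_add_le (∑ i, u i * (∫ x, H i j θstar x ∂P - Abar i j)
      + (-b j - N j + ∑ i, u i * Abar i j)) (N j)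
    have t3 := abs_add_le (∑ i, u i * (∫ x, H i j θstar x ∂P - Abar i j))
      (-b j - N j + ∑ i, u i * Abar i j)
    have t4 := hexp j
    rw [mul_add]
    linarith
  have hfin := (hbound u).trans (mul_le_mul_of_nonneg_left
    (Finset.sum_le_sum fun j (_ : j ∈ Finset.univ) => hcol j) hc.le)
  rw [Finset.sum_add_distrib, ← Finset.mul_sum] at hfin
  -- The oscillation and the deviation of the average Hessian from its mean account for at most half
  -- of `‖u‖`; moving this half to the left doubles the constant to `2 * c`.
  have h6 : c * (‖u‖ * ∑ j, (∑ i, |∫ x, H i j θstar x ∂P - Abar i j| + wbar)) ≤ ‖u‖ / 2 := by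
    calc _ ≤ c * (‖u‖ * (1 / (2 * c))) := by gcongr
      _ = ‖u‖ / 2 := by field_simp
  rw [mul_add] at hfin
  linarith

/-- The squared estimation error times the sample size is bounded in probability: multiplied by a
sequence that vanishes in probability, it vanishes in probability. -/
theorem tendsto_sq_norm_sub_mul [IsFiniteMeasure μ] (h : LocalScore P θstar ρ sc H)
    (hs : WeakLawObs μ p s P) (hθ : Tendsto θhat (probFilter μ) (𝓝 θstar))
    (hdet : IsUnit (Matrix.of fun i j => ∫ x, H i j θstar x ∂P).det)
    (hfoc : ∀ᶠ z in probFilter μ, ∀ j, ∑ t ∈ Finset.Icc 1 z.1, sc j (θhat z) (s t z.2) = 0)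
    (hmart : ∀ j, ∃ c : ℝ≥0∞, c ≠ ⊤ ∧ ∀ᶠ T : ℕ in atTop,
      ∫⁻ ω, ENNReal.ofReal ((∑ t ∈ Finset.Ioc p T, sc j θstar (s t ω)) ^ 2 / T) ∂μ ≤ c)
    {q : ℕ × Ω → ℝ} (hq0 : ∀ z, 0 ≤ q z) (hq : Tendsto q (probFilter μ) (𝓝 0)) :
    Tendsto (fun z : ℕ × Ω => ‖θhat z - θstar‖ ^ 2 * z.1 * q z) (probFilter μ) (𝓝 0) := by
  obtain ⟨c, hc, hrate⟩ := h.exists_eventually_norm_sub_le hs hθ hdet hfoc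
  have hini (j : Fin v) := hs.exists_initial_bound (isCompact_closedBall θstar (ρ / 2))
    (fun x => (h.continuousOn_sc j x).mono h.closedBall_half_subset)
    (fun θ hθ => h.measurable_sc j θ (h.closedBall_half_subset hθ))
    (eventually_mem_closedBall hθ (half_pos h.pos))
  choose C hCm hC using hini
  have hX (j : Fin v) : Tendsto (fun z : ℕ × Ω =>
      (∑ t ∈ Finset.Ioc p z.1, sc j θstar (s t z.2)) ^ 2 / z.1 * q z) (probFilter μ) (𝓝 0) := by
    obtain ⟨k, hk, hk'⟩ := hmart j
    refine tendsto_mul_probFilter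
      (X := fun z : ℕ × Ω => (∑ t ∈ Finset.Ioc p z.1, sc j θstar (s t z.2)) ^ 2 / (z.1 : ℝ)) hk
      (fun z => by positivity) (fun T => ?_) hk' hq
    have hm : Measurable fun ω => ∑ t ∈ Finset.Ioc p T, sc j θstar (s t ω) :=
      Finset.measurable_sum _ fun t ht => (h.measurable_sc j θstar h.mem_ball).comp
        (hs.measurable t (by have := Finset.mem_Ioc.1 ht; omega))
    exact ((hm.pow_const 2).div_const (T : ℝ)).aemeasurable
  have hY (j : Fin v) : Tendsto (fun z : ℕ × Ω => C j z.2 ^ 2 / z.1 * q z) (probFilter μ)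
      (𝓝 0) := by
    simpa using (tendsto_div_probFilter (μ := μ) ((hCm j).pow_const 2)).mul hq
  have hlim : Tendsto (fun z : ℕ × Ω => c ^ 2 * (v * ∑ j, 2 *
      ((∑ t ∈ Finset.Ioc p z.1, sc j θstar (s t z.2)) ^ 2 / z.1 * q z + C j z.2 ^ 2 / z.1 * q z)))
      (probFilter μ) (𝓝 0) := by
    have := ((tendsto_finsetSum Finset.univ fun j _ =>
      (((hX j).add (hY j)).const_mul 2)).const_mul (v : ℝ)).const_mul (c ^ 2)
    simpa using this
  refine squeeze_zero' (Eventually.of_forall fun z =>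
    mul_nonneg (by positivity) (hq0 z)) ?_ hlim
  filter_upwards [hrate, eventually_all.2 hC, WeakLawObs.eventually_le_fst 1] with z h1 h2 h3
  have hT : (0 : ℝ) < z.1 := by exact_mod_cast h3
  set a : Fin v → ℝ := fun j => ∑ t ∈ Finset.Ioc p z.1, sc j θstar (s t z.2)
  set b : Fin v → ℝ := fun j => ∑ t ∈ Finset.Icc 1 p, sc j (θhat z) (s t z.2)
  -- The factor `v` comes from Cauchy–Schwarz over the components, the factor `2` from `(x + y)² ≤ 2
  -- (x² + y²)`.
  have h4 : ‖θhat z - θstar‖ ^ 2 ≤ c ^ 2 * (v * ∑ j, 2 * (a j ^ 2 + C j z.2 ^ 2) / z.1 ^ 2) := by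
    calc ‖θhat z - θstar‖ ^ 2 ≤ (c * ∑ j, (|a j / z.1| + |b j / z.1|)) ^ 2 := by gcongr
      _ = c ^ 2 * (∑ j, (|a j / z.1| + |b j / z.1|)) ^ 2 := by ring
      _ ≤ c ^ 2 * (v * ∑ j, (|a j / z.1| + |b j / z.1|) ^ 2) := by
        gcongr
        simpa using sq_sum_le_card_mul_sum_sq (s := (Finset.univ : Finset (Fin v)))
          (f := fun j => |a j / (z.1 : ℝ)| + |b j / z.1|)
      _ ≤ _ := by
        gcongr with j
        have e1 : (|a j / (z.1 : ℝ)| + |b j / z.1|) ^ 2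
            ≤ 2 * ((a j / (z.1 : ℝ)) ^ 2 + (b j / z.1) ^ 2) := by
          have := add_sq_le (a := |a j / (z.1 : ℝ)|) (b := |b j / z.1|)
          simpa only [sq_abs] using this
        refine e1.trans ?_
        rw [div_pow, div_pow, ← add_div, mul_div_assoc]
        have e2 : b j ^ 2 ≤ C j z.2 ^ 2 := sq_le_sq' (abs_le.1 (h2 j)).1 (abs_le.1 (h2 j)).2
        gcongr
  calc ‖θhat z - θstar‖ ^ 2 * z.1 * q z
      ≤ c ^ 2 * (v * ∑ j, 2 * (a j ^ 2 + C j z.2 ^ 2) / z.1 ^ 2) * z.1 * q z := by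
        have := hq0 z
        gcongr
    _ = _ := by
      simp only [Finset.mul_sum, Finset.sum_mul]
      refine Finset.sum_congr rfl fun j _ => ?_
      simp only [a]
      field_simp

/-- The average outer product of the scores at a consistent root of the score equation. -/
theorem tendsto_average_outer [IsFiniteMeasure μ] (h : LocalScore P θstar ρ sc H)
    (hs : WeakLawObs μ p s P) (hθ : Tendsto θhat (probFilter μ) (𝓝 θstar))
    (hdet : IsUnit (Matrix.of fun i j => ∫ x, H i j θstar x ∂P).det)
    (hfoc : ∀ᶠ z in probFilter μ, ∀ j, ∑ t ∈ Finset.Icc 1 z.1, sc j (θhat z) (s t z.2) = 0)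
    (hmart : ∀ j, ∃ c : ℝ≥0∞, c ≠ ⊤ ∧ ∀ᶠ T : ℕ in atTop,
      ∫⁻ ω, ENNReal.ofReal ((∑ t ∈ Finset.Ioc p T, sc j θstar (s t ω)) ^ 2 / T) ∂μ ≤ c)
    (hmem : ∀ j, MemLp (sc j θstar) 2 P) (i j : Fin v) :
    Tendsto (fun z : ℕ × Ω =>
      (∑ t ∈ Finset.Icc 1 z.1, sc i (θhat z) (s t z.2) * sc j (θhat z) (s t z.2)) / z.1)
      (probFilter μ) (𝓝 (∫ x, sc i θstar x * sc j θstar x ∂P)) := by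
  refine hs.tendsto_full_average (g := fun θ x => sc i θ x * sc j θ x)
    (isCompact_closedBall θstar (ρ / 2))
    (fun x => ((h.continuousOn_sc i x).mul (h.continuousOn_sc j x)).mono h.closedBall_half_subset)
    (fun θ hθ => (h.measurable_sc i θ (h.closedBall_half_subset hθ)).mul
      (h.measurable_sc j θ (h.closedBall_half_subset hθ)))
    (eventually_mem_closedBall hθ (half_pos h.pos)) ?_
  obtain ⟨w, hwm, hw0, hw, hle⟩ := h.exists_envelope
  -- The two rates meet here: the score is Lipschitz with constant `w`, and `T⁻¹ ∑ w² ‖θhat -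
  -- θstar‖²` is `T ‖θhat - θstar‖²` times the vanishing sequence `T⁻² ∑ w²`.
  have hdiff (j : Fin v) : Tendsto (fun z : ℕ × Ω => (∑ t ∈ Finset.Ioc p z.1,
      (sc j (θhat z) (s t z.2) - sc j θstar (s t z.2)) ^ 2) / (z.1 : ℝ)) (probFilter μ) (𝓝 0) := by
    refine squeeze_zero' (Eventually.of_forall fun z => by positivity) ?_
      (h.tendsto_sq_norm_sub_mul hs hθ hdet hfoc hmart (fun z => by positivity)
        (hs.tendsto_sum_sq_div_sq hwm hw0 hw))
    filter_upwards [eventually_mem_ball hθ h.pos, WeakLawObs.eventually_le_fst 1,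
      eventually_probFilter_of_ae (μ := μ) (q := fun z => ∀ t, p < t →
        ∀ θ ∈ Metric.ball θstar ρ, ∑ i, ∑ j, |H i j θ (s t z.2)| ≤ w (s t z.2))
        fun _ => hs.ae_of_ae hle] with z h1 h2 h3
    have hT : (0 : ℝ) < z.1 := by exact_mod_cast h2
    calc (∑ t ∈ Finset.Ioc p z.1, (sc j (θhat z) (s t z.2) - sc j θstar (s t z.2)) ^ 2) / (z.1 : ℝ)
        ≤ (∑ t ∈ Finset.Ioc p z.1, w (s t z.2) ^ 2 * ‖θhat z - θstar‖ ^ 2) / z.1 := by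
          gcongr with t ht
          rw [← mul_pow, ← sq_abs]
          gcongr
          exact h.abs_sc_sub_le (h3 t (Finset.mem_Ioc.1 ht).1) h1 j
      _ = _ := by
        rw [← Finset.sum_mul]
        field_simp
  have hsq (j : Fin v) := hs.tendsto_average _ (hmem j).integrable_sq
  -- Writing each score as its value at `θstar` plus an increment gives four products; the three
  -- with an increment vanish by Cauchy–Schwarz.
  have h1 := tendsto_average_mul_of_tendsto_average_sq (hdiff i) (hdiff j)
  have h2 := tendsto_average_mul_of_tendsto_average_sq (hdiff i) (hsq j)
  have h3 := tendsto_average_mul_of_tendsto_average_sq (hdiff j) (hsq i)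
  have h4 := hs.tendsto_average (fun x => sc i θstar x * sc j θstar x)
    ((hmem i).integrable_mul (hmem j))
  have h5 := ((h1.add h2).add h3).add h4
  simp only [zero_add] at h5
  refine h5.congr fun z => ?_
  rw [← add_div, ← add_div, ← add_div, ← Finset.sum_add_distrib, ← Finset.sum_add_distrib,
    ← Finset.sum_add_distrib]
  congr 1
  exact Finset.sum_congr rfl fun t _ => by ring

end LocalScore

end ATM

/-! ### The joint law of a data point, and identification of the parameter. -/

/-- Two measures on a product with an open interval agree if they agree on rectangles with
half-open intervals. -/
lemma MeasureTheory.Measure.ext_prod_Ioc {W : Type*} [MeasurableSpace W] {Ξ : Set ℝ}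
    (hΞ : IsOpen Ξ) (hΞc : Ξ.OrdConnected) {P ν : Measure (W × ℝ)} [IsFiniteMeasure P]
    (hP : P (Set.univ ×ˢ Ξᶜ) = 0) (hν : ν (Set.univ ×ˢ Ξᶜ) = 0)
    (h : ∀ B, MeasurableSet B → ∀ u ∈ Ξ, ∀ y ∈ Ξ, u < y →
      P (B ×ˢ Set.Ioc u y) = ν (B ×ˢ Set.Ioc u y)) : P = ν := by
  refine Measure.ext_prod fun {B A} hB hA => ?_
  set κ : Measure (W × ℝ) → Measure ℝ := fun Q => (Q.restrict (B ×ˢ Set.univ)).map Prod.snd with hκ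
  have hκa (Q : Measure (W × ℝ)) {A : Set ℝ} (hA : MeasurableSet A) : κ Q A = Q (B ×ˢ A) := by
    rw [hκ]
    simp only
    rw [Measure.map_apply measurable_snd hA, Measure.restrict_apply (measurable_snd hA)]
    congr 1
    ext ⟨w, y⟩
    simp [and_comm]
  have hκΞ (Q : Measure (W × ℝ)) (hQ : Q (Set.univ ×ˢ Ξᶜ) = 0) : (κ Q).restrict Ξ = κ Q := by
    refine Measure.restrict_eq_self_of_ae_mem ?_
    rw [ae_iff]
    change κ Q Ξᶜ = 0
    rw [hκa Q hΞ.measurableSet.compl]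
    exact measure_mono_null (Set.prod_mono (Set.subset_univ _) le_rfl) hQ
  have hfin : IsFiniteMeasure (κ P) := by rw [hκ]; infer_instance
  have hmain : κ P = κ ν := by
    rw [← hκΞ P hP, ← hκΞ ν hν]
    -- Countably many half-open intervals with rational endpoints in `Ξ` exhaust it. Inside each one
    -- all subintervals have endpoints in `Ξ`, where the hypothesis applies.
    have hcov : Ξ = ⋃ q : {q : ℚ × ℚ // (q.1 : ℝ) ∈ Ξ ∧ (q.2 : ℝ) ∈ Ξ},
        Set.Ioc (q.1.1 : ℝ) (q.1.2 : ℝ) := by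
      ext y
      simp only [Set.mem_iUnion, Subtype.exists, Prod.exists]
      constructor
      · intro hy
        obtain ⟨ε, hε, hball⟩ := Metric.isOpen_iff.1 hΞ y hy
        obtain ⟨a, ha1, ha2⟩ := exists_rat_btwn (show y - ε < y by linarith)
        obtain ⟨b, hb1, hb2⟩ := exists_rat_btwn (show y < y + ε by linarith)
        refine ⟨a, b, ⟨hball ?_, hball ?_⟩, ha2, hb1.le⟩ <;>
        · rw [Metric.mem_ball, Real.dist_eq, abs_lt]
          constructor <;> linarith
      · rintro ⟨a, b, ⟨ha, hb⟩, h1, h2⟩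
        exact hΞc.out ha hb ⟨h1.le, h2⟩
    rw [hcov, Measure.restrict_iUnion_congr]
    rintro ⟨⟨a, b⟩, ha, hb⟩
    refine Measure.ext_of_Ioc _ _ fun c e hce => ?_
    rw [Measure.restrict_apply measurableSet_Ioc, Measure.restrict_apply measurableSet_Ioc,
      Set.Ioc_inter_Ioc, hκa _ measurableSet_Ioc, hκa _ measurableSet_Ioc]
    rcases lt_or_ge (max c (a : ℝ)) (min e (b : ℝ)) with hlt | hge
    · exact h B hB _ (hΞc.out ha hb ⟨le_max_right _ _, hlt.le.trans (min_le_right _ _)⟩) _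
        (hΞc.out ha hb ⟨(le_max_right _ _).trans hlt.le, min_le_right _ _⟩) hlt
    · rw [Set.Ioc_eq_empty (not_lt.2 hge)]
      simp
  rw [← hκa P hA, hmain, hκa ν hA]

namespace ATM

noncomputable section

/-- The error distribution as a measure. -/
def ErrorDist.law (Z : ErrorDist) : Measure ℝ :=
  volume.withDensity fun z => ENNReal.ofReal (Z.pdf z)

lemma ErrorDist.measurable_pdf (Z : ErrorDist) : Measurable Z.pdf :=
  Z.contDiff_pdf.continuous.measurable

instance (Z : ErrorDist) : IsProbabilityMeasure Z.law := by
  refine ⟨?_⟩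
  rw [ErrorDist.law, withDensity_apply _ MeasurableSet.univ, setLIntegral_univ,
    ← ofReal_integral_eq_lintegral_ofReal Z.integrable_pdf
      (ae_of_all _ fun z => (Z.pdf_pos z).le), Z.integral_pdf, ENNReal.ofReal_one]

lemma ErrorDist.ofReal_cdf (Z : ErrorDist) (z : ℝ) : ENNReal.ofReal (Z.cdf z)
    = Z.law (Set.Iic z) := by
  rw [ErrorDist.cdf, ErrorDist.law, withDensity_apply _ measurableSet_Iic,
    ofReal_integral_eq_lintegral_ofReal Z.integrable_pdf.integrableOn
      (ae_of_all _ fun z => (Z.pdf_pos z).le)]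

lemma ErrorDist.cdf_nonneg (Z : ErrorDist) (z : ℝ) : 0 ≤ Z.cdf z :=
  setIntegral_nonneg measurableSet_Iic fun u _ => (Z.pdf_pos u).le

lemma ErrorDist.measurable_law_Iic (Z : ErrorDist) : Measurable fun z => Z.law (Set.Iic z) :=
  Monotone.measurable fun _ _ h => measure_mono (Set.Iic_subset_Iic.2 h)

variable {v p d : ℕ} {𝒳 : Type*} [MeasurableSpace 𝒳]

namespace ATModel

variable (M : ATModel v p d 𝒳)

/-- The transformation, with the basis functions set to zero outside of the sample space. -/
def trans (θ : Param v) (w : 𝒳 × (Fin p → ℝ)) (y : ℝ) : ℝ :=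
  ∑ m, M.Ξ.indicator M.a y m * M.ϑ θ w.1 m +
    (∑ j, M.φ θ j * ∑ m, M.Ξ.indicator M.a (w.2 j) m * M.ϑ θ w.1 m + M.r θ w.1)

/-- The derivative of the transformation. -/
def slope (θ : Param v) (x : 𝒳) (y : ℝ) : ℝ := ∑ m, deriv M.a y m * M.ϑ θ x m

open Classical in
/-- The conditional log-density of an observation `s.2` given the features and lags `s.1`. -/
def logDens (Z : ErrorDist) (θ : Param v) (s : (𝒳 × (Fin p → ℝ)) × ℝ) : ℝ :=
  if s.2 ∈ M.Ξ then Real.log (Z.pdf (M.trans θ s.1 s.2)) + Real.log (M.slope θ s.1.1 s.2) else 0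

variable {M}

lemma h_eq_trans {θ : Param v} {w : 𝒳 × (Fin p → ℝ)} (hw : ∀ j, w.2 j ∈ M.Ξ) {y : ℝ}
    (hy : y ∈ M.Ξ) : M.h θ w.1 w.2 y = M.trans θ w y := by
  simp only [h, h₁, h₂, trans, Set.indicator_of_mem hy, Set.indicator_of_mem (hw _)]

lemma hasDerivAt_h₁ (θ : Param v) (x : 𝒳) {y : ℝ} (hy : y ∈ M.Ξ) :
    HasDerivAt (M.h₁ θ x) (M.slope θ x y) y := by
  have h := hasDerivAt_pi.1 (M.differentiableAt_a y hy).hasDerivAt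
  exact HasDerivAt.fun_sum fun m _ => (h m).mul_const _

lemma slope_pos {θ : Param v} (hθ : θ ∈ M.Θ) (x : 𝒳) {y : ℝ} (hy : y ∈ M.Ξ) :
    0 < M.slope θ x y := by
  rw [← (hasDerivAt_h₁ θ x hy).deriv]
  exact M.deriv_pos θ hθ x y hy

lemma hasDerivAt_trans (θ : Param v) (w : 𝒳 × (Fin p → ℝ)) {y : ℝ} (hy : y ∈ M.Ξ) :
    HasDerivAt (M.trans θ w) (M.slope θ w.1 y) y := by
  refine ((hasDerivAt_h₁ θ w.1 hy).add_const
    (∑ j, M.φ θ j * ∑ m, M.Ξ.indicator M.a (w.2 j) m * M.ϑ θ w.1 m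
      + M.r θ w.1)).congr_of_eventuallyEq ?_
  filter_upwards [M.isOpen_Ξ.mem_nhds hy] with u hu
  simp only [trans, h₁, Set.indicator_of_mem hu]

lemma continuousOn_trans (θ : Param v) (w : 𝒳 × (Fin p → ℝ)) :
    ContinuousOn (M.trans θ w) M.Ξ := fun _ hy =>
  (hasDerivAt_trans θ w hy).continuousAt.continuousWithinAt

lemma strictMonoOn_trans {θ : Param v} (hθ : θ ∈ M.Θ) (w : 𝒳 × (Fin p → ℝ)) :
    StrictMonoOn (M.trans θ w) M.Ξ := by
  refine strictMonoOn_of_deriv_pos M.ordConnected_Ξ.convex (continuousOn_trans θ w) fun y hy => ?_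
  rw [(hasDerivAt_trans θ w (interior_subset hy)).deriv]
  exact slope_pos hθ _ (interior_subset hy)

lemma image_Ioc_trans {θ : Param v} (hθ : θ ∈ M.Θ) (w : 𝒳 × (Fin p → ℝ)) {u y : ℝ}
    (hu : u ∈ M.Ξ) (hy : y ∈ M.Ξ) (huy : u < y) :
    M.trans θ w '' Set.Ioc u y = Set.Ioc (M.trans θ w u) (M.trans θ w y) := by
  have hsub : Set.Icc u y ⊆ M.Ξ := M.ordConnected_Ξ.out hu hy
  refine Set.Subset.antisymm ?_ (intermediate_value_Ioc huy.le
    ((continuousOn_trans θ w).mono hsub))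
  rintro _ ⟨x, hx, rfl⟩
  have hxΞ := hsub ⟨hx.1.le, hx.2⟩
  exact ⟨strictMonoOn_trans hθ w hu hxΞ hx.1, (strictMonoOn_trans hθ w).monotoneOn hxΞ hy hx.2⟩

/-- The reason for cutting the basis off in `trans`: nothing is known about `a` outside `Ξ`, while
on `Ξ` it is continuous. -/
lemma measurable_indicator_a : Measurable (M.Ξ.indicator M.a) := by
  classical
  rw [← Set.piecewise_eq_indicator]
  exact ContinuousOn.measurable_piecewise
    (fun y hy => (M.differentiableAt_a y hy).continuousAt.continuousWithinAt)
    continuousOn_const M.isOpen_Ξ.measurableSet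

lemma measurable_trans {θ : Param v} (hθ : θ ∈ M.Θ) :
    Measurable fun s : (𝒳 × (Fin p → ℝ)) × ℝ => M.trans θ s.1 s.2 := by
  have hϑ (m : Fin d) : Measurable fun s : (𝒳 × (Fin p → ℝ)) × ℝ => M.ϑ θ s.1.1 m :=
    (measurable_pi_apply m).comp ((M.measurable_ϑ θ hθ).comp (measurable_fst.comp measurable_fst))
  have ha (m : Fin d) : Measurable fun y => M.Ξ.indicator M.a y m :=
    (measurable_pi_apply m).comp measurable_indicator_a
  have hr : Measurable fun s : (𝒳 × (Fin p → ℝ)) × ℝ => M.r θ s.1.1 :=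
    (M.measurable_r θ hθ).comp (measurable_fst.comp measurable_fst)
  refine (Finset.measurable_sum _ fun m _ => ((ha m).comp measurable_snd).mul (hϑ m)).add
    ((Finset.measurable_sum _ fun j _ => Measurable.const_mul (Finset.measurable_sum _ fun m _ =>
      Measurable.mul ?_ (hϑ m)) _).add hr)
  exact (ha m).comp ((measurable_pi_apply j).comp (measurable_snd.comp measurable_fst))

lemma measurable_slope {θ : Param v} (hθ : θ ∈ M.Θ) :
    Measurable fun s : (𝒳 × (Fin p → ℝ)) × ℝ => M.slope θ s.1.1 s.2 := by
  refine Finset.measurable_sum _ fun m _ => Measurable.mul ?_ ?_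
  · exact (measurable_pi_apply m).comp ((measurable_deriv M.a).comp measurable_snd)
  · exact (measurable_pi_apply m).comp
      ((M.measurable_ϑ θ hθ).comp (measurable_fst.comp measurable_fst))

lemma measurable_logDens (Z : ErrorDist) {θ : Param v} (hθ : θ ∈ M.Θ) :
    Measurable (M.logDens Z θ) := by
  classical
  refine Measurable.ite (measurable_snd M.isOpen_Ξ.measurableSet) ?_ measurable_const
  exact ((Z.measurable_pdf.comp (measurable_trans hθ)).log).add (measurable_slope hθ).log

lemma continuousOn_logDens (Z : ErrorDist) (s : (𝒳 × (Fin p → ℝ)) × ℝ) :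
    ContinuousOn (fun θ => M.logDens Z θ s) M.Θ := by
  by_cases hs : s.2 ∈ M.Ξ
  · simp only [logDens, hs, if_true]
    have hϑ := continuousOn_pi.1 (M.continuousOn_ϑ s.1.1)
    have hφ := continuousOn_pi.1 M.continuousOn_φ
    have htr : ContinuousOn (fun θ => M.trans θ s.1 s.2) M.Θ :=
      (continuousOn_finsetSum _ fun m _ => continuousOn_const.mul (hϑ m)).add
        ((continuousOn_finsetSum _ fun j _ => (hφ j).mul
          (continuousOn_finsetSum _ fun m _ => continuousOn_const.mul (hϑ m))).add
          (M.continuousOn_r s.1.1))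
    have hsl : ContinuousOn (fun θ => M.slope θ s.1.1 s.2) M.Θ :=
      continuousOn_finsetSum _ fun m _ => continuousOn_const.mul (hϑ m)
    exact ((Z.contDiff_pdf.continuous.comp_continuousOn htr).log
      fun θ _ => (Z.pdf_pos _).ne').add (hsl.log fun θ hθ => (slope_pos hθ _ hs).ne')
  · simp only [logDens, hs, if_false]
    exact continuousOn_const

lemma contDiffOn_logDens (Z : ErrorDist) (s : (𝒳 × (Fin p → ℝ)) × ℝ) :
    ContDiffOn ℝ 2 (fun θ => M.logDens Z θ s) (interior M.Θ) := by
  by_cases hs : s.2 ∈ M.Ξ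
  · simp only [logDens, hs, if_true]
    have hϑ := contDiffOn_pi.1 (M.contDiffOn_ϑ s.1.1)
    have hφ := contDiffOn_pi.1 M.contDiffOn_φ
    have htr : ContDiffOn ℝ 2 (fun θ => M.trans θ s.1 s.2) (interior M.Θ) :=
      (ContDiffOn.sum fun m _ => contDiffOn_const.mul (hϑ m)).add
        ((ContDiffOn.sum fun j _ => (hφ j).mul
          (ContDiffOn.sum fun m _ => contDiffOn_const.mul (hϑ m))).add (M.contDiffOn_r s.1.1))
    have hsl : ContDiffOn ℝ 2 (fun θ => M.slope θ s.1.1 s.2) (interior M.Θ) :=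
      ContDiffOn.sum fun m _ => contDiffOn_const.mul (hϑ m)
    exact ((Z.contDiff_pdf.comp_contDiffOn htr).log fun θ _ => (Z.pdf_pos _).ne').add
      (hsl.log fun θ hθ => (slope_pos (interior_subset hθ) _ hs).ne')
  · simp only [logDens, hs, if_false]
    exact contDiffOn_const

/-- The conditional density gives a set of observations the mass of its image under the error
distribution. -/
lemma lintegral_dens (Z : ErrorDist) {θ : Param v} (hθ : θ ∈ M.Θ) (w : 𝒳 × (Fin p → ℝ))
    {A : Set ℝ} (hA : MeasurableSet A) (hAΞ : A ⊆ M.Ξ) :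
    ∫⁻ y in A, ENNReal.ofReal (Real.exp (M.logDens Z θ (w, y))) = Z.law (M.trans θ w '' A) := by
  rw [ErrorDist.law, withDensity_apply',
    lintegral_image_eq_lintegral_abs_deriv_mul hA
      (fun y hy => (hasDerivAt_trans θ w (hAΞ hy)).hasDerivWithinAt)
      ((strictMonoOn_trans hθ w).injOn.mono hAΞ)]
  refine setLIntegral_congr_fun hA fun y hy => ?_
  have hs := slope_pos hθ w.1 (hAΞ hy)
  simp only [logDens, hAΞ hy, if_true]
  rw [Real.exp_add, Real.exp_log (Z.pdf_pos _), Real.exp_log hs, abs_of_pos hs,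
    ENNReal.ofReal_mul (Z.pdf_pos _).le, mul_comm]

/-- If the conditional density has full mass, then it belongs to the distribution function
`F_Z ∘ h`. -/
lemma law_Iic_trans (Z : ErrorDist) {θ : Param v} (hθ : θ ∈ M.Θ) {w : 𝒳 × (Fin p → ℝ)}
    (h1 : Z.law (M.trans θ w '' M.Ξ) = 1) {y : ℝ} (hy : y ∈ M.Ξ) :
    Z.law (Set.Iic (M.trans θ w y)) = Z.law (M.trans θ w '' (M.Ξ ∩ Set.Iic y)) := by
  have hmono := strictMonoOn_trans hθ w
  have hm : MeasurableSet (M.trans θ w '' M.Ξ) :=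
    M.isOpen_Ξ.measurableSet.image_of_continuousOn_injOn (continuousOn_trans θ w) hmono.injOn
  -- The image of `Ξ` need not be the whole line; full mass makes the part of the half-line outside
  -- it negligible.
  have h0 : Z.law (M.trans θ w '' M.Ξ)ᶜ = 0 := (prob_compl_eq_zero_iff hm).2 h1
  refine le_antisymm ?_ (measure_mono ?_)
  · rw [← add_zero (Z.law (M.trans θ w '' (M.Ξ ∩ Set.Iic y))), ← h0]
    refine (measure_mono fun z hz => ?_).trans (measure_union_le _ _)
    by_cases hzi : z ∈ M.trans θ w '' M.Ξ
    · obtain ⟨y', hy', rfl⟩ := hzi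
      exact Or.inl ⟨y', ⟨hy', (hmono.le_iff_le hy' hy).1 hz⟩, rfl⟩
    · exact Or.inr hzi
  · rintro _ ⟨y', ⟨hy', hle⟩, rfl⟩
    exact hmono.monotoneOn hy' hy hle

section Gibbs

variable {Z : ErrorDist} {P : Measure ((𝒳 × (Fin p → ℝ)) × ℝ)}
  {PW : Measure (𝒳 × (Fin p → ℝ))} [IsProbabilityMeasure PW] {θ θstar : Param v}

/-- The joint law of features, lags and observation under the parameter `θ`. -/
def jointLaw (M : ATModel v p d 𝒳) (Z : ErrorDist) (PW : Measure (𝒳 × (Fin p → ℝ)))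
    (θ : Param v) : Measure ((𝒳 × (Fin p → ℝ)) × ℝ) :=
  (PW.prod (volume.restrict M.Ξ)).withDensity
    fun s => ENNReal.ofReal (Real.exp (M.logDens Z θ s))

lemma measurable_dens (hθ : θ ∈ M.Θ) :
    Measurable fun s => ENNReal.ofReal (Real.exp (M.logDens Z θ s)) :=
  (Real.measurable_exp.comp (measurable_logDens Z hθ)).ennreal_ofReal

lemma jointLaw_prod (hθ : θ ∈ M.Θ) {B : Set (𝒳 × (Fin p → ℝ))} (hB : MeasurableSet B)
    {A : Set ℝ} (hA : MeasurableSet A) (hAΞ : A ⊆ M.Ξ) :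
    jointLaw M Z PW θ (B ×ˢ A) = ∫⁻ w in B, Z.law (M.trans θ w '' A) ∂PW := by
  rw [jointLaw, withDensity_apply _ (hB.prod hA), ← Measure.prod_restrict,
    Measure.restrict_restrict_of_subset hAΞ, lintegral_prod _ (measurable_dens hθ).aemeasurable]
  exact lintegral_congr fun w => lintegral_dens Z hθ w hA hAΞ

/-- The likelihood ratio times the density at `θstar` is the density at `θ`. Its conditional mass is
that of the image of `Ξ` under the error law, which may be less than one. -/
lemma lintegral_exp_sub_le_one (hθ : θ ∈ M.Θ) (hstar : θstar ∈ M.Θ) :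
    ∫⁻ s, ENNReal.ofReal (Real.exp (M.logDens Z θ s - M.logDens Z θstar s))
      ∂(jointLaw M Z PW θstar) ≤ 1 := by
  have hm : Measurable fun s =>
      ENNReal.ofReal (Real.exp (M.logDens Z θ s - M.logDens Z θstar s)) :=
    (Real.measurable_exp.comp ((measurable_logDens Z hθ).sub
      (measurable_logDens Z hstar))).ennreal_ofReal
  rw [jointLaw, lintegral_withDensity_eq_lintegral_mul _ (measurable_dens hstar) hm]
  have (s : (𝒳 × (Fin p → ℝ)) × ℝ) : ((fun s => ENNReal.ofReal (Real.exp (M.logDens Z θstar s))) *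
      fun s => ENNReal.ofReal (Real.exp (M.logDens Z θ s - M.logDens Z θstar s))) s
      = ENNReal.ofReal (Real.exp (M.logDens Z θ s)) := by
    rw [Pi.mul_apply, ← ENNReal.ofReal_mul (Real.exp_pos _).le, ← Real.exp_add,
      add_sub_cancel]
  simp only [this]
  rw [lintegral_prod _ (measurable_dens hθ).aemeasurable]
  calc _ = ∫⁻ w, Z.law (M.trans θ w '' M.Ξ) ∂PW :=
        lintegral_congr fun w => lintegral_dens Z hθ w M.isOpen_Ξ.measurableSet le_rfl
    _ ≤ ∫⁻ _, 1 ∂PW := lintegral_mono fun w => prob_le_one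
    _ = 1 := by simp

/-- A parameter whose mean log-likelihood is not smaller than the one of `θstar` has the same
conditional distribution functions. -/
theorem cdf_eq_of_not_lintegral_lt (hθ : θ ∈ M.Θ) (hstar : θstar ∈ M.Θ)
    [IsProbabilityMeasure (jointLaw M Z PW θstar)]
    (h : ¬ ∫⁻ s, ENNReal.ofReal (M.logDens Z θ s - M.logDens Z θstar s + 1)
      ∂(jointLaw M Z PW θstar) < 1) :
    ∀ᵐ w ∂PW, ∀ y ∈ M.Ξ, Z.cdf (M.trans θ w y) = Z.cdf (M.trans θstar w y) := by
  have hD : Measurable fun s => M.logDens Z θ s - M.logDens Z θstar s :=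
    (measurable_logDens Z hθ).sub (measurable_logDens Z hstar)
  have hae : ∀ᵐ s ∂(jointLaw M Z PW θstar), M.logDens Z θ s = M.logDens Z θstar s := by
    have hle := lintegral_exp_sub_le_one (Z := Z) (PW := PW) hθ hstar
    -- The chain `1 ≤ E (D + 1)⁺ ≤ E (exp D) ≤ 1` forces `(D + 1)⁺ = exp D` almost surely; as `D + 1
    -- < exp D` unless `D = 0`, the log-densities agree.
    have heq := ae_eq_of_ae_le_of_lintegral_le (μ := jointLaw M Z PW θstar)
      (f := fun s => ENNReal.ofReal (M.logDens Z θ s - M.logDens Z θstar s + 1))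
      (g := fun s => ENNReal.ofReal (Real.exp (M.logDens Z θ s - M.logDens Z θstar s)))
      (ae_of_all _ fun s => ENNReal.ofReal_le_ofReal (Real.add_one_le_exp _))
      (ne_top_of_le_ne_top ENNReal.one_ne_top ((lintegral_mono fun s =>
        ENNReal.ofReal_le_ofReal (Real.add_one_le_exp _)).trans hle))
      (Real.measurable_exp.comp hD).ennreal_ofReal.aemeasurable (hle.trans (not_lt.1 h))
    filter_upwards [heq] with s hs
    by_contra hne
    have h1 := Real.add_one_lt_exp (sub_ne_zero.2 hne)
    exact ((ENNReal.ofReal_lt_ofReal_iff (Real.exp_pos _)).2 h1).ne hs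
  rw [jointLaw, ae_withDensity_iff (measurable_dens hstar)] at hae
  have hae2 := Measure.ae_ae_of_ae_prod hae
  -- Conditional masses never exceed one and average to one, since the joint law is a probability
  -- measure. So they equal one, and equality of densities carries this over to `θ`.
  have hmass : ∀ᵐ w ∂PW, Z.law (M.trans θstar w '' M.Ξ) = 1 := by
    have h1 : jointLaw M Z PW θstar (Set.univ ×ˢ M.Ξ) = 1 := by
      rw [← measure_univ (μ := jointLaw M Z PW θstar)]
      refine measure_congr (ae_eq_univ.2 ?_)
      rw [jointLaw]
      refine withDensity_absolutelyContinuous _ _ ?_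
      rw [Set.compl_prod_eq_union]
      simp [M.isOpen_Ξ.measurableSet]
    rw [jointLaw_prod hstar MeasurableSet.univ M.isOpen_Ξ.measurableSet le_rfl,
      setLIntegral_univ] at h1
    refine ae_eq_of_ae_le_of_lintegral_le (ae_of_all _ fun w => prob_le_one) (by rw [h1]; simp)
      aemeasurable_const ?_
    rw [h1]
    simp
  filter_upwards [hae2, hmass] with w hw hm y hy
  have hlaw {A : Set ℝ} (hA : MeasurableSet A) (hAΞ : A ⊆ M.Ξ) :
      Z.law (M.trans θ w '' A) = Z.law (M.trans θstar w '' A) := by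
    rw [← lintegral_dens Z hθ w hA hAΞ, ← lintegral_dens Z hstar w hA hAΞ]
    refine lintegral_congr_ae (ae_restrict_of_ae_restrict_of_subset hAΞ ?_)
    filter_upwards [hw] with y hy
    rw [hy (by simpa using Real.exp_pos _)]
  have hfin : ENNReal.ofReal (Z.cdf (M.trans θ w y))
      = ENNReal.ofReal (Z.cdf (M.trans θstar w y)) := by
    rw [Z.ofReal_cdf, Z.ofReal_cdf, law_Iic_trans Z hstar hm hy, law_Iic_trans Z hθ
      (by rw [hlaw M.isOpen_Ξ.measurableSet le_rfl, hm]) hy]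
    exact hlaw (M.isOpen_Ξ.measurableSet.inter measurableSet_Iic) Set.inter_subset_left
  exact (ENNReal.ofReal_eq_ofReal_iff (Z.cdf_nonneg _) (Z.cdf_nonneg _)).1 hfin

end Gibbs

end ATModel

end

end ATM

/-! ### From the time series to the joint law and the weak law. -/

namespace ATM

noncomputable section

variable {v p d : ℕ} {𝒳 Ω : Type*}

/-- The features and the lags at time `t`. -/
def predictors (p : ℕ) (Y : ℤ → Ω → ℝ) (X : ℕ → Ω → 𝒳) (t : ℕ) (ω : Ω) : 𝒳 × (Fin p → ℝ) :=
  (X t ω, lags p Y t ω)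

/-- The features, the lags and the observation at time `t`. -/
def obs (p : ℕ) (Y : ℤ → Ω → ℝ) (X : ℕ → Ω → 𝒳) (t : ℕ) (ω : Ω) : (𝒳 × (Fin p → ℝ)) × ℝ :=
  (predictors p Y X t ω, Y t ω)

/-- The observation at time `p + 1 + n` as a function of the shifted path. -/
def pathObs (p : ℕ) (s : ℕ → ℝ × 𝒳) : (𝒳 × (Fin p → ℝ)) × ℝ :=
  (((s p).2, fun j : Fin p => (s (p - 1 - j)).1), (s p).1)

/-- Index `k` of the path is time `k + 1`, so time `p + 1` sits at index `p`, the earliest whose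
lags all lie on the path; starting values no longer occur. -/
lemma obs_eq_pathObs (Y : ℤ → Ω → ℝ) (X : ℕ → Ω → 𝒳) (n : ℕ) (ω : Ω) : obs p Y X (p + 1 + n) ω
    = pathObs p ((fun (s : ℕ → ℝ × 𝒳) k => s (k + 1))^[n] (path Y X ω)) := by
  have hshift (n : ℕ) (s : ℕ → ℝ × 𝒳) :
      (fun (s : ℕ → ℝ × 𝒳) k => s (k + 1))^[n] s = fun k => s (k + n) := by
    induction n generalizing s with
    | zero => rfl
    | succ n ih =>
      rw [Function.iterate_succ_apply, ih]
      rfl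
  rw [hshift]
  simp only [obs, predictors, pathObs, path, Prod.mk.injEq]
  refine ⟨⟨?_, funext fun j => ?_⟩, ?_⟩
  · congr 1; omega
  · simp only [lags]
    congr 1
    have := j.2
    omega
  · congr 1; push_cast; ring

variable [MeasurableSpace 𝒳] [mΩ : MeasurableSpace Ω] {μ : Measure Ω} {Z : ErrorDist} {M : ATModel v p d 𝒳}
  {ℱ : Filtration ℕ mΩ} {Y : ℤ → Ω → ℝ} {X : ℕ → Ω → 𝒳}

namespace IsData

lemma lags_mem (h : IsData M ℱ Y X) {t : ℕ} (ht : 1 ≤ t) (ω : Ω) (j : Fin p) :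
    lags p Y t ω j ∈ M.Ξ := h.mem_Ξ _ (by have := j.2; omega) ω

lemma Y_mem (h : IsData M ℱ Y X) {t : ℕ} (ht : 1 ≤ t) (ω : Ω) : Y t ω ∈ M.Ξ :=
  h.mem_Ξ _ (by omega) ω

lemma measurable_predictors (h : IsData M ℱ Y X) {t : ℕ} (ht : 1 ≤ t) :
    Measurable[ℱ (t - 1)] (predictors p Y X t) := by
  have hl : Measurable[ℱ (t - 1)] (lags p Y t) := by
    rw [@measurable_pi_iff _ _ _ (ℱ (t - 1))]
    intro j
    have hj := j.2
    exact (h.measurable_Y ((t : ℤ) - ((j : ℤ) + 1)) (by omega)).mono (ℱ.mono (by omega)) le_rfl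
  exact Measurable.prodMk (h.measurable_X t ht) hl

lemma measurable_Y_nat (h : IsData M ℱ Y X) {t : ℕ} (ht : 1 ≤ t) : Measurable (Y t) :=
  (h.measurable_Y t (by omega)).mono (ℱ.le _) le_rfl

lemma measurable_obs (h : IsData M ℱ Y X) {t : ℕ} (ht : 1 ≤ t) : Measurable (obs p Y X t) :=
  ((h.measurable_predictors ht).mono (ℱ.le _) le_rfl).prodMk (h.measurable_Y_nat ht)

lemma h_eq_trans (h : IsData M ℱ Y X) (θ : Param v) {t : ℕ} (ht : 1 ≤ t) (ω : Ω) {y : ℝ}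
    (hy : y ∈ M.Ξ) :
    M.h θ (X t ω) (lags p Y t ω) y = M.trans θ (predictors p Y X t ω) y :=
  ATModel.h_eq_trans (w := predictors p Y X t ω) (h.lags_mem ht ω) hy

lemma ell_eq (h : IsData M ℱ Y X) {t : ℕ} (ht : 1 ≤ t) (θ : Param v) (ω : Ω) :
    ell Z M Y X t θ ω = M.logDens Z θ (obs p Y X t ω) := by
  have hy := h.Y_mem ht ω
  have hd : deriv (fun y => M.h θ (X t ω) (lags p Y t ω) y) (Y t ω)
      = M.slope θ (X t ω) (Y t ω) :=
    ((ATModel.hasDerivAt_h₁ θ (X t ω) hy).add_const (M.h₂ θ (X t ω) (lags p Y t ω))).deriv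
  rw [ell, hd, Real.log_abs, h.h_eq_trans θ ht ω hy, ATModel.logDens, if_pos]
  · rfl
  · exact hy

/-- Features and lags are known at time `t - 1`, so the conditional distribution function may be
integrated over any event they determine. -/
lemma map_obs_prod_Iic [IsProbabilityMeasure μ] (h : IsData M ℱ Y X) {θ : Param v}
    (hθ : θ ∈ M.Θ) (htrue : IsTrueParam μ Z M ℱ Y X θ) {t : ℕ} (ht : p < t)
    {B : Set (𝒳 × (Fin p → ℝ))} (hB : MeasurableSet B) {y : ℝ} (hy : y ∈ M.Ξ) :
    (μ.map (obs p Y X t)) (B ×ˢ Set.Iic y)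
      = ∫⁻ w in B, Z.law (Set.Iic (M.trans θ w y)) ∂(μ.map (predictors p Y X t)) := by
  have ht1 : 1 ≤ t := by omega
  have hpm := h.measurable_predictors ht1
  have hpm' : Measurable (predictors p Y X t) := hpm.mono (ℱ.le _) le_rfl
  have hBm : MeasurableSet[ℱ (t - 1)] (predictors p Y X t ⁻¹' B) := hpm hB
  have hYm : MeasurableSet (Y t ⁻¹' Set.Iic y) := h.measurable_Y_nat ht1 measurableSet_Iic
  have hlaw : Measurable fun w => Z.law (Set.Iic (M.trans θ w y)) :=
    Z.measurable_law_Iic.comp ((ATModel.measurable_trans hθ).comp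
      (measurable_id.prodMk measurable_const))
  have hce := htrue t ht y hy
  have hint : Integrable ((Y t ⁻¹' Set.Iic y).indicator fun _ => (1 : ℝ)) μ :=
    (integrable_const 1).indicator hYm
  have h1 : ∫ ω in predictors p Y X t ⁻¹' B, Z.cdf (M.h θ (X t ω) (lags p Y t ω) y) ∂μ
      = μ.real (predictors p Y X t ⁻¹' B ∩ Y t ⁻¹' Set.Iic y) := by
    rw [← setIntegral_congr_ae (ℱ.le _ _ hBm) (hce.mono fun ω hω _ => hω),
      setIntegral_condExp (ℱ.le _) hint hBm, setIntegral_indicator hYm]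
    simp
  have hcint : Integrable (fun ω => Z.cdf (M.h θ (X t ω) (lags p Y t ω) y)) μ :=
    integrable_condExp.congr hce
  rw [Measure.map_apply (h.measurable_obs ht1) (hB.prod measurableSet_Iic),
    setLIntegral_map hB hlaw hpm']
  have h2 : obs p Y X t ⁻¹' (B ×ˢ Set.Iic y) = predictors p Y X t ⁻¹' B ∩ Y t ⁻¹' Set.Iic y := rfl
  rw [h2, ← ofReal_measureReal, ← h1, ofReal_integral_eq_lintegral_ofReal hcint.integrableOn
    (ae_of_all _ fun ω => Z.cdf_nonneg _)]
  refine lintegral_congr fun ω => ?_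
  rw [h.h_eq_trans θ ht1 ω hy, Z.ofReal_cdf]

/-- Under a true parameter, features, lags and observation have the joint law of the model. -/
theorem map_obs_eq_jointLaw [IsProbabilityMeasure μ] (h : IsData M ℱ Y X) {θ : Param v}
    (hθ : θ ∈ M.Θ) (htrue : IsTrueParam μ Z M ℱ Y X θ) {t : ℕ} (ht : p < t) :
    μ.map (obs p Y X t) = ATModel.jointLaw M Z (μ.map (predictors p Y X t)) θ := by
  have ht1 : 1 ≤ t := by omega
  have hpm' : Measurable (predictors p Y X t) :=
    (h.measurable_predictors ht1).mono (ℱ.le _) le_rfl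
  have : IsProbabilityMeasure (μ.map (predictors p Y X t)) :=
    Measure.isProbabilityMeasure_map hpm'.aemeasurable
  have : IsProbabilityMeasure (μ.map (obs p Y X t)) :=
    Measure.isProbabilityMeasure_map (h.measurable_obs ht1).aemeasurable
  have hΞ := M.isOpen_Ξ.measurableSet
  refine Measure.ext_prod_Ioc M.isOpen_Ξ M.ordConnected_Ξ ?_ ?_ ?_
  · rw [Measure.map_apply (h.measurable_obs ht1) (MeasurableSet.univ.prod hΞ.compl)]
    have : obs p Y X t ⁻¹' (Set.univ ×ˢ M.Ξᶜ) = ∅ := by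
      ext ω
      simpa [obs] using h.Y_mem ht1 ω
    rw [this, measure_empty]
  · refine withDensity_absolutelyContinuous _ _ ?_
    rw [Measure.prod_prod, Measure.restrict_apply hΞ.compl]
    simp
  · intro B hB u hu y hy huy
    rw [ATModel.jointLaw_prod hθ hB measurableSet_Ioc
      (fun x hx => M.ordConnected_Ξ.out hu hy ⟨hx.1.le, hx.2⟩)]
    simp only [ATModel.image_Ioc_trans hθ _ hu hy huy]
    have hlaw (y : ℝ) : Measurable fun w => Z.law (Set.Iic (M.trans θ w y)) :=
      Z.measurable_law_Iic.comp ((ATModel.measurable_trans hθ).comp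
        (measurable_id.prodMk measurable_const))
    -- Subtracting the identity at `u` from the one at `y` removes the error mass below the image of
    -- `Ξ`, which the density does not see.
    have hsplit (w) : Z.law (Set.Iic (M.trans θ w y))
        = Z.law (Set.Iic (M.trans θ w u)) + Z.law (Set.Ioc (M.trans θ w u) (M.trans θ w y)) := by
      rw [← measure_union _ measurableSet_Ioc,
        Set.Iic_union_Ioc_eq_Iic ((ATModel.strictMonoOn_trans hθ w).monotoneOn hu hy huy.le)]
      exact Set.disjoint_left.2 fun z h1 h2 => absurd h2.1 (not_lt.2 h1)
    have hy' := h.map_obs_prod_Iic hθ htrue ht hB hy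
    simp only [hsplit] at hy'
    rw [lintegral_add_left (hlaw u), ← h.map_obs_prod_Iic hθ htrue ht hB hu,
      ← Set.Iic_union_Ioc_eq_Iic huy.le, Set.prod_union, measure_union _
        (hB.prod measurableSet_Ioc)] at hy'
    · exact (ENNReal.add_right_inj (measure_ne_top _ _)).1 hy'
    · exact Set.disjoint_left.2 fun z h1 h2 => absurd h2.2.1 (not_lt.2 h1.2)

lemma measurable_pathObs : Measurable (pathObs p : (ℕ → ℝ × 𝒳) → _) := by
  refine Measurable.prodMk (Measurable.prodMk (measurable_pi_apply p).snd
    (measurable_pi_iff.2 fun j => (measurable_pi_apply _).fst)) (measurable_pi_apply p).fst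

lemma measurable_path (h : IsData M ℱ Y X) : Measurable (path Y X) := by
  refine measurable_pi_iff.2 fun k => Measurable.prodMk ?_ ?_
  · exact (h.measurable_Y ((k : ℤ) + 1) (by omega)).mono (ℱ.le _) le_rfl
  · exact (h.measurable_X (k + 1) (by omega)).mono (ℱ.le _) le_rfl

/-- The observations of a stationary and ergodic series satisfy the weak law of large numbers. -/
theorem weakLawObs [IsProbabilityMeasure μ] (h : IsData M ℱ Y X)
    (hse : IsStationaryErgodic μ Y X) :
    WeakLawObs μ p (obs p Y X) (μ.map (obs p Y X (p + 1))) := by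
  have hpath := h.measurable_path
  have : IsProbabilityMeasure (μ.map (path Y X)) :=
    Measure.isProbabilityMeasure_map hpath.aemeasurable
  set τ : (ℕ → ℝ × 𝒳) → (ℕ → ℝ × 𝒳) := fun s k => s (k + 1) with hτ
  have herg : Ergodic τ (μ.map (path Y X)) := hse
  have hmp := herg.toMeasurePreserving
  have hobs (n : ℕ) : μ.map (obs p Y X (p + 1 + n)) = (μ.map (path Y X)).map (pathObs p) := by
    have h1 : obs p Y X (p + 1 + n) = pathObs p ∘ τ^[n] ∘ path Y X :=
      funext fun ω => obs_eq_pathObs Y X n ω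
    rw [h1, ← Measure.map_map measurable_pathObs ((hmp.iterate n).measurable.comp hpath),
      ← Measure.map_map (hmp.iterate n).measurable hpath, (hmp.iterate n).map_eq]
  refine ⟨fun t ht => h.measurable_obs ht, fun t ht => ?_, fun g hg => ?_⟩
  · obtain ⟨n, rfl⟩ := Nat.exists_eq_add_of_le (show p + 1 ≤ t from ht)
    rw [hobs n, ← hobs 0]
  · have hP : μ.map (obs p Y X (p + 1)) = (μ.map (path Y X)).map (pathObs p) := hobs 0
    rw [hP] at hg ⊢
    have hG : Integrable (g ∘ pathObs p) (μ.map (path Y X)) :=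
      (integrable_map_measure hg.1 measurable_pathObs.aemeasurable).1 hg
    have hI : ∫ x, g x ∂((μ.map (path Y X)).map (pathObs p))
        = ∫ x, (g ∘ pathObs p) x ∂(μ.map (path Y X)) :=
      integral_map measurable_pathObs.aemeasurable hg.1
    rw [hI]
    have hL1 := herg.tendsto_eLpNorm_birkhoffAverage hG
    set c := ∫ x, (g ∘ pathObs p) x ∂(μ.map (path Y X)) with hc
    have hL1' : Tendsto (fun n => eLpNorm (fun ω =>
        birkhoffAverage ℝ τ (g ∘ pathObs p) n (path Y X ω) - c) 1 μ) atTop (𝓝 0) := by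
      refine hL1.congr fun n => ?_
      exact eLpNorm_map_measure ((hmp.memLp_birkhoffAverage (memLp_one_iff_integrable.2 hG)
        n).1.sub aestronglyMeasurable_const) hpath.aemeasurable
    have hmeas : TendstoInMeasure μ (fun n ω =>
        birkhoffAverage ℝ τ (g ∘ pathObs p) n (path Y X ω)) atTop fun _ => c := by
      refine tendstoInMeasure_of_tendsto_eLpNorm one_ne_zero (fun n => ?_)
        aestronglyMeasurable_const hL1'
      exact (hmp.memLp_birkhoffAverage (memLp_one_iff_integrable.2 hG) n).1.comp_measurable hpath
    have hmeas' := tendsto_probFilter_of_tendstoInMeasure (hmeas.comp (tendsto_sub_atTop_nat p))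
    -- The times `p < t ≤ T` form a Birkhoff sum of length `T - p`, but the average divides by `T`.
    have hratio : Tendsto (fun z : ℕ × Ω => ((z.1 - p : ℕ) : ℝ) / z.1) (probFilter μ) (𝓝 1) := by
      have h1 : Tendsto (fun T : ℕ => 1 - (p : ℝ) / T) atTop (𝓝 1) := by
        simpa using (tendsto_const_div_atTop_nhds_zero_nat (p : ℝ)).const_sub 1
      have h2 : Tendsto (fun T : ℕ => ((T - p : ℕ) : ℝ) / T) atTop (𝓝 1) := by
        refine h1.congr' ?_
        filter_upwards [eventually_ge_atTop (p + 1)] with T hT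
        rw [Nat.cast_sub (by omega), sub_div, div_self]
        exact_mod_cast (by omega : T ≠ 0)
      exact h2.comp tendsto_fst_probFilter
    have hprod := hratio.mul hmeas'
    rw [one_mul] at hprod
    refine hprod.congr' ?_
    filter_upwards [WeakLawObs.eventually_le_fst (p + 1)] with z hz
    have hsum : ∑ t ∈ Finset.Ioc p z.1, g (obs p Y X t z.2)
        = ∑ k ∈ Finset.range (z.1 - p), (g ∘ pathObs p) (τ^[k] (path Y X z.2)) := by
      have h1 : Finset.Ioc p z.1 = Finset.Ico (p + 1) (z.1 + 1) := by
        ext t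
        simp only [Finset.mem_Ioc, Finset.mem_Ico]
        omega
      rw [h1, Finset.sum_Ico_eq_sum_range, show z.1 + 1 - (p + 1) = z.1 - p by omega]
      exact Finset.sum_congr rfl fun k _ => by rw [obs_eq_pathObs]; rfl
    rw [hsum]
    simp only [Function.comp_apply, birkhoffAverage, birkhoffSum, smul_eq_mul]
    have : ((z.1 - p : ℕ) : ℝ) ≠ 0 := by
      have : z.1 - p ≠ 0 := by omega
      exact_mod_cast this
    field_simp

end IsData

end

end ATM

/-! ### Score and Hessian as functions of the data; verification of the abstract hypotheses. -/

namespace ATM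

noncomputable section

section Frobenius

attribute [local instance] Matrix.frobeniusSeminormedAddCommGroup

lemma ofReal_sum_abs_le_enorm {v : ℕ} (A : Matrix (Fin v) (Fin v) ℝ) :
    ENNReal.ofReal (∑ i, ∑ j, |A i j|) ≤ ENNReal.ofReal ((v : ℝ) * v) * ‖A‖ₑ := by
  have hentry (i j : Fin v) : |A i j| ≤ ‖A‖ := by
    rw [Matrix.frobenius_norm_def, ← Real.sqrt_eq_rpow]
    refine Real.le_sqrt_of_sq_le ?_
    simp only [Real.norm_eq_abs, Real.rpow_ofNat]
    refine le_trans ?_ (Finset.single_le_sum (f := fun i => ∑ j, |A i j| ^ 2)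
      (fun _ _ => Finset.sum_nonneg fun _ _ => sq_nonneg _) (Finset.mem_univ i))
    exact Finset.single_le_sum (f := fun j => |A i j| ^ 2) (fun _ _ => sq_nonneg _)
      (Finset.mem_univ j)
  rw [← ofReal_norm, ← ENNReal.ofReal_mul (by positivity)]
  refine ENNReal.ofReal_le_ofReal ?_
  calc ∑ i, ∑ j, |A i j| ≤ ∑ _i : Fin v, ∑ _j : Fin v, ‖A‖ :=
        Finset.sum_le_sum fun i _ => Finset.sum_le_sum fun j _ => hentry i j
    _ = v * v * ‖A‖ := by simp; ring

end Frobenius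

variable {v p d : ℕ} {𝒳 : Type*} [MeasurableSpace 𝒳] {Ω : Type*}

/-- The score of a single observation as a function of the data. -/
def dataScore (Z : ErrorDist) (M : ATModel v p d 𝒳) (j : Fin v) (θ : Param v)
    (x : (𝒳 × (Fin p → ℝ)) × ℝ) : ℝ :=
  fderiv ℝ (fun η => M.logDens Z η x) θ (basisVec j)

/-- The observed Hessian of a single observation as a function of the data. -/
def dataHess (Z : ErrorDist) (M : ATModel v p d 𝒳) (i j : Fin v) (θ : Param v)
    (x : (𝒳 × (Fin p → ℝ)) × ℝ) : ℝ :=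
  -fderiv ℝ (fun ζ => dataScore Z M j ζ x) θ (basisVec i)

variable [mΩ : MeasurableSpace Ω] {μ : Measure Ω} {Z : ErrorDist} {M : ATModel v p d 𝒳}
  {ℱ : Filtration ℕ mΩ} {Y : ℤ → Ω → ℝ} {X : ℕ → Ω → 𝒳} {θstar : Param v}

lemma IsData.score_eq (h : IsData M ℱ Y X) {t : ℕ} (ht : 1 ≤ t) (θ : Param v) (ω : Ω)
    (j : Fin v) : score Z M Y X t θ ω j = dataScore Z M j θ (obs p Y X t ω) := by
  simp only [score, dataScore, h.ell_eq ht]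

lemma IsData.hess_eq (h : IsData M ℱ Y X) {t : ℕ} (ht : 1 ≤ t) (θ : Param v) (ω : Ω)
    (i j : Fin v) : hess Z M Y X t θ ω i j = dataHess Z M i j θ (obs p Y X t ω) := by
  simp only [hess, dataHess, dataScore, h.ell_eq ht, Matrix.of_apply]

lemma contDiffOn_dataScore (j : Fin v) (x : (𝒳 × (Fin p → ℝ)) × ℝ) :
    ContDiffOn ℝ 1 (fun θ => dataScore Z M j θ x) (interior M.Θ) :=
  ((ATModel.contDiffOn_logDens Z x).fderiv_of_isOpen isOpen_interior
    (by norm_num)).clm_apply contDiffOn_const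

lemma measurable_dataScore (j : Fin v) {θ : Param v} (hθ : θ ∈ interior M.Θ) :
    Measurable (dataScore Z M j θ) :=
  measurable_fderiv_apply_param isOpen_interior
    (fun _ hη => ATModel.measurable_logDens Z (interior_subset hη)) hθ
    (fun x => ((ATModel.contDiffOn_logDens Z x).contDiffAt
      (isOpen_interior.mem_nhds hθ)).differentiableAt (by norm_num)) _

lemma differentiableAt_dataScore (j : Fin v) (x : (𝒳 × (Fin p → ℝ)) × ℝ) {θ : Param v}
    (hθ : θ ∈ interior M.Θ) : DifferentiableAt ℝ (fun η => dataScore Z M j η x) θ :=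
  ((contDiffOn_dataScore j x).contDiffAt (isOpen_interior.mem_nhds hθ)).differentiableAt
    (by norm_num)

lemma measurable_dataHess (i j : Fin v) {θ : Param v} (hθ : θ ∈ interior M.Θ) :
    Measurable (dataHess Z M i j θ) :=
  (measurable_fderiv_apply_param isOpen_interior (fun _ hη => measurable_dataScore j hη) hθ
    (fun x => differentiableAt_dataScore j x hθ) _).neg

lemma continuousOn_dataHess (i j : Fin v) (x : (𝒳 × (Fin p → ℝ)) × ℝ) :
    ContinuousOn (fun θ => dataHess Z M i j θ x) (interior M.Θ) :=
  (((contDiffOn_dataScore j x).continuousOn_fderiv_of_isOpen isOpen_interior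
    (by norm_num)).clm_apply continuousOn_const).neg

/-- The radius is the smaller of two: one keeps the ball in the interior of `Θ`, where derivatives
exist, the other is that of the Hessian moment condition. -/
lemma Conditions.exists_localScore (hdata : IsData M ℱ Y X) (hint : θstar ∈ interior M.Θ)
    (hcond : Conditions μ Z M ℱ Y X θstar) :
    ∃ ρ, Metric.ball θstar ρ ⊆ interior M.Θ ∧ LocalScore (μ.map (obs p Y X (p + 1))) θstar ρ
      (dataScore Z M) (dataHess Z M) := by
  obtain ⟨r, hr, hball⟩ := Metric.isOpen_iff.1 isOpen_interior θstar hint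
  obtain ⟨ξ, hξ, hsup⟩ := hcond.sup_hess
  have hsub : Metric.ball θstar (min r ξ) ⊆ interior M.Θ :=
    (Metric.ball_subset_ball (min_le_left _ _)).trans hball
  refine ⟨min r ξ, hsub, lt_min hr hξ, fun j x θ hθ => differentiableAt_dataScore j x (hsub hθ),
    fun i j x θ _ => by simp [dataHess], fun j θ hθ => measurable_dataScore j (hsub hθ),
    fun i j x => (continuousOn_dataHess i j x).mono hsub,
    fun i j θ hθ => measurable_dataHess i j (hsub hθ), ?_⟩
  refine (lintegral_map_le _ _).trans_lt ?_
  refine (lintegral_mono (g := fun ω => ENNReal.ofReal ((v : ℝ) * v) * _) fun ω => ?_).trans_lt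
    (lt_of_eq_of_lt (lintegral_const_mul' _ _ ENNReal.ofReal_ne_top)
      (ENNReal.mul_lt_top ENNReal.ofReal_lt_top (hsup (p + 1) (by omega))))
  simp only [ENNReal.mul_iSup]
  refine iSup_mono fun θ => ?_
  refine iSup_mono' fun hθ => ⟨Metric.ball_subset_ball (min_le_right _ _) hθ, ?_⟩
  simp only [← hdata.hess_eq (show 1 ≤ p + 1 by omega)]
  exact ofReal_sum_abs_le_enorm _

/-- Identification: every other parameter has a smaller mean log-likelihood. -/
lemma Conditions.lintegral_lt_one [IsProbabilityMeasure μ] (hdata : IsData M ℱ Y X)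
    (hint : θstar ∈ interior M.Θ) (htrue : IsTrueParam μ Z M ℱ Y X θstar)
    (hcond : Conditions μ Z M ℱ Y X θstar) {θ : Param v} (hθ : θ ∈ M.Θ) (hne : θ ≠ θstar) :
    ∫⁻ x, ENNReal.ofReal (M.logDens Z θ x - M.logDens Z θstar x + 1)
      ∂(μ.map (obs p Y X (p + 1))) < 1 := by
  by_contra hnot
  refine hne (hcond.unique_true θ hθ fun t ht y hy => ?_)
  have hstar := interior_subset hint
  have ht1 : 1 ≤ t := by omega
  have hpm : Measurable (predictors p Y X t) :=
    (hdata.measurable_predictors ht1).mono (ℱ.le _) le_rfl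
  have : IsProbabilityMeasure (μ.map (predictors p Y X t)) :=
    Measure.isProbabilityMeasure_map hpm.aemeasurable
  have hlaw := hdata.map_obs_eq_jointLaw hstar htrue ht
  have : IsProbabilityMeasure (ATModel.jointLaw M Z (μ.map (predictors p Y X t)) θstar) := by
    rw [← hlaw]
    exact Measure.isProbabilityMeasure_map (hdata.measurable_obs ht1).aemeasurable
  -- Being a true value concerns every `t > p`; stationarity carries the failed inequality from time
  -- `p + 1` to time `t`.
  rw [← (hdata.weakLawObs hcond.stationaryErgodic).map_eq t ht, hlaw] at hnot
  have hcdf := ae_of_ae_map hpm.aemeasurable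
    (ATModel.cdf_eq_of_not_lintegral_lt hθ hstar hnot)
  filter_upwards [hcdf, htrue t ht y hy] with ω h1 h2
  rw [h2, hdata.h_eq_trans θ ht1 ω hy, hdata.h_eq_trans θstar ht1 ω hy, h1 y hy]

lemma Conditions.memLp_dataScore (hdata : IsData M ℱ Y X)
    (hint : θstar ∈ interior M.Θ) (hcond : Conditions μ Z M ℱ Y X θstar) (j : Fin v) :
    MemLp (dataScore Z M j θstar) 2 (μ.map (obs p Y X (p + 1))) := by
  rw [memLp_map_measure_iff (measurable_dataScore j hint).aestronglyMeasurable
    (hdata.measurable_obs (by omega)).aemeasurable]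
  have h := hcond.score_memLp (p + 1) (by omega) j
  simp only [hdata.score_eq (show 1 ≤ p + 1 by omega)] at h
  exact h

/-- The score at the true value is of the order of the root of the sample size. -/
lemma Conditions.exists_lintegral_sq_sum_le [IsProbabilityMeasure μ] (hdata : IsData M ℱ Y X)
    (hint : θstar ∈ interior M.Θ) (hcond : Conditions μ Z M ℱ Y X θstar) (j : Fin v) :
    ∃ c : ℝ≥0∞, c ≠ ⊤ ∧ ∀ᶠ T : ℕ in atTop, ∫⁻ ω, ENNReal.ofReal
      ((∑ t ∈ Finset.Ioc p T, dataScore Z M j θstar (obs p Y X t ω)) ^ 2 / T) ∂μ ≤ c := by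
  have hs := hdata.weakLawObs hcond.stationaryErgodic
  set c : ℝ := ∫ x, dataScore Z M j θstar x ^ 2 ∂(μ.map (obs p Y X (p + 1))) with hc
  have hc0 : 0 ≤ c := integral_nonneg fun _ => sq_nonneg _
  have hfun (t : ℕ) (ht : p < t) : (fun ω => score Z M Y X t θstar ω j)
      = fun ω => dataScore Z M j θstar (obs p Y X t ω) :=
    funext fun ω => hdata.score_eq (by omega) θstar ω j
  have hmem (t : ℕ) (ht : p < t) : MemLp (fun ω => dataScore Z M j θstar (obs p Y X t ω)) 2 μ := by
    rw [← hfun t ht]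
    exact hcond.score_memLp t ht j
  have hvar := integral_sq_sum_of_martingaleDifference (μ := μ) (ℱ := ℱ) (p := p)
    (ξ := fun t ω => dataScore Z M j θstar (obs p Y X t ω)) (c := c)
    (fun t ht => by
      rw [← hfun t ht]
      exact (continuous_apply j).comp_stronglyMeasurable (hcond.score_adapted t ht))
    hmem
    (fun t ht => by
      rw [← hfun t ht]
      exact hcond.score_condExp t ht j)
    (fun t ht => by
      rw [hc, ← hs.map_eq t ht, integral_map (hs.measurable t (by omega)).aemeasurable]
      exact ((measurable_dataScore j hint).pow_const 2).aestronglyMeasurable)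
  refine ⟨ENNReal.ofReal c, ENNReal.ofReal_ne_top, ?_⟩
  filter_upwards [eventually_ge_atTop (p + 1)] with T hT
  obtain ⟨n, rfl⟩ := Nat.exists_eq_add_of_le (show p ≤ T by omega)
  have hS : MemLp (fun ω => ∑ t ∈ Finset.Ioc p (p + n),
      dataScore Z M j θstar (obs p Y X t ω)) 2 μ :=
    memLp_finsetSum _ fun t ht => hmem t (Finset.mem_Ioc.1 ht).1
  rw [← ofReal_integral_eq_lintegral_ofReal (hS.integrable_sq.div_const _)
    (ae_of_all _ fun ω => by positivity), integral_div, hvar n]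
  -- With `T = p + n` the mean square is `n * c / (p + n)`, which is at most `c`.
  refine ENNReal.ofReal_le_ofReal ?_
  have : (0 : ℝ) < ((p + n : ℕ) : ℝ) := by exact_mod_cast (by omega : 0 < p + n)
  rw [div_le_iff₀ this, mul_comm]
  gcongr
  omega

/-- Interior maximum likelihood estimators solve the score equations. -/
lemma sum_dataScore_eq_zero {T : ℕ} {θ : Param v} (hθ : θ ∈ interior M.Θ)
    {x : ℕ → (𝒳 × (Fin p → ℝ)) × ℝ}
    (hmin : IsMinOn (fun θ => -∑ t ∈ Finset.Icc 1 T, M.logDens Z θ (x t)) M.Θ θ) (j : Fin v) :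
    ∑ t ∈ Finset.Icc 1 T, dataScore Z M j θ (x t) = 0 := by
  have hloc := (hmin.isLocalMin (mem_interior_iff_mem_nhds.1 hθ)).fderiv_eq_zero
  have hder : HasFDerivAt (fun θ => -∑ t ∈ Finset.Icc 1 T, M.logDens Z θ (x t))
      (-∑ t ∈ Finset.Icc 1 T, fderiv ℝ (fun η => M.logDens Z η (x t)) θ) θ :=
    (HasFDerivAt.fun_sum fun t _ => (((ATModel.contDiffOn_logDens Z (x t)).contDiffAt
      (isOpen_interior.mem_nhds hθ)).differentiableAt (by norm_num)).hasFDerivAt).neg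
  rw [hder.fderiv] at hloc
  have := congrArg (fun A : Param v →L[ℝ] ℝ => A (basisVec j)) hloc
  simpa [dataScore] using this

end

end ATM

/-! ### Assembly. -/

theorem theorem3 {Ω : Type*} [mΩ : MeasurableSpace Ω] (μ : Measure Ω) [IsProbabilityMeasure μ]
    {𝒳 : Type*} [MeasurableSpace 𝒳] {v p d : ℕ}
    (Z : ATM.ErrorDist) (M : ATM.ATModel v p d 𝒳) (ℱ : Filtration ℕ mΩ)
    (Y : ℤ → Ω → ℝ) (X : ℕ → Ω → 𝒳) (hdata : ATM.IsData M ℱ Y X)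
    (θstar : ATM.Param v) (hint : θstar ∈ interior M.Θ)
    (htrue : ATM.IsTrueParam μ Z M ℱ Y X θstar)
    (hcond : ATM.Conditions μ Z M ℱ Y X θstar)
    (θhat : ℕ → Ω → ATM.Param v) (hmle : ATM.IsMLE μ Z M Y X θhat) :
    ATM.IsConsistent μ (ATM.hessEst Z M Y X θhat) (ATM.infoMatrix μ Z M Y X θstar) ∧
    ATM.IsConsistent μ (ATM.outerEst Z M Y X θhat) (ATM.outerMatrix μ Z M Y X θstar) := by
  have hs := hdata.weakLawObs hcond.stationaryErgodic
  have hobs : Measurable (ATM.obs p Y X (p + 1)) := hdata.measurable_obs (by omega)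
  have hp1 : 1 ≤ p + 1 := by omega
  have hlog (T : ℕ) (θ : ATM.Param v) (ω : Ω) : ATM.logLik Z M Y X T θ ω
      = ∑ t ∈ Finset.Icc 1 T, M.logDens Z θ (ATM.obs p Y X t ω) :=
    Finset.sum_congr rfl fun t ht => hdata.ell_eq (Finset.mem_Icc.1 ht).1 θ ω
  have hmle' : ∀ᶠ z in probFilter μ, θhat z.1 z.2 ∈ M.Θ ∧
      IsMinOn (fun θ => -∑ t ∈ Finset.Icc 1 z.1, M.logDens Z θ (ATM.obs p Y X t z.2)) M.Θ
        (θhat z.1 z.2) := by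
    simp only [← hlog]
    exact eventually_probFilter_of_ae hmle
  have hθ : Tendsto (fun z : ℕ × Ω => θhat z.1 z.2) (probFilter μ) (𝓝 θstar) := by
    refine hs.tendsto_of_isMaximizer M.isCompact_Θ (fun x => ATM.ATModel.continuousOn_logDens Z x)
      (fun θ hθ => ATM.ATModel.measurable_logDens Z hθ) (interior_subset hint) ?_ ?_
      (hmle'.mono fun z hz => hz.1) ?_
      (fun θ hθ hne => hcond.lintegral_lt_one hdata hint htrue hθ hne)
    · refine (lintegral_map_le _ _).trans_lt ?_
      simp only [← hdata.ell_eq hp1]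
      exact hcond.sup_ell (p + 1) (by omega)
    · refine (integrable_map_measure
        (ATM.ATModel.measurable_logDens Z (interior_subset hint)).aestronglyMeasurable
        hobs.aemeasurable).2 ?_
      refine (hcond.integrable_ell (p + 1) (by omega)).congr (ae_of_all _ fun ω => ?_)
      exact hdata.ell_eq hp1 θstar ω
    · filter_upwards [hmle'] with z hz
      exact neg_le_neg_iff.1 (hz.2 (interior_subset hint))
  obtain ⟨ρ, hsub, hloc⟩ := hcond.exists_localScore hdata hint
  have hinfo : ATM.infoMatrix μ Z M Y X θstar = Matrix.of fun i j =>
      ∫ x, ATM.dataHess Z M i j θstar x ∂(μ.map (ATM.obs p Y X (p + 1))) := by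
    ext i j
    rw [Matrix.of_apply, integral_map hobs.aemeasurable
      (ATM.measurable_dataHess i j hint).aestronglyMeasurable]
    simp only [ATM.infoMatrix, Matrix.of_apply, hdata.hess_eq hp1]
  have houter (i j : Fin v) : ATM.outerMatrix μ Z M Y X θstar i j =
      ∫ x, ATM.dataScore Z M i θstar x * ATM.dataScore Z M j θstar x
        ∂(μ.map (ATM.obs p Y X (p + 1))) := by
    have hm : Measurable fun x => ATM.dataScore Z M i θstar x * ATM.dataScore Z M j θstar x :=
      (ATM.measurable_dataScore i hint).mul (ATM.measurable_dataScore j hint)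
    rw [integral_map hobs.aemeasurable hm.aestronglyMeasurable]
    simp only [ATM.outerMatrix, ATM.outer, Matrix.of_apply, Matrix.vecMulVec_apply,
      hdata.score_eq hp1]
  refine ⟨fun i j => tendstoInMeasure_of_tendsto_probFilter ?_,
    fun i j => tendstoInMeasure_of_tendsto_probFilter ?_⟩
  · rw [hinfo]
    refine (hloc.tendsto_average_H hs hθ i j).congr fun z => ?_
    rw [ATM.hessEst, Matrix.smul_apply, Matrix.sum_apply, smul_eq_mul, one_div_mul_eq_div]
    congr 1
    exact Finset.sum_congr rfl fun t ht => (hdata.hess_eq (Finset.mem_Icc.1 ht).1 _ _ i j).symm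
  · rw [houter]
    have hdet := hcond.infoMatrix_posDef.det_pos.ne'.isUnit
    rw [hinfo] at hdet
    refine (hloc.tendsto_average_outer hs hθ hdet ?_
      (fun j => hcond.exists_lintegral_sq_sum_le hdata hint j)
      (fun j => hcond.memLp_dataScore hdata hint j) i j).congr fun z => ?_
    -- Consistency puts the estimator into the interior of `Θ` with probability tending to one, and
    -- there a minimizer is a critical point.
    · filter_upwards [ATM.LocalScore.eventually_mem_ball hθ hloc.pos, hmle'] with z h1 h2 j
      exact ATM.sum_dataScore_eq_zero (hsub h1) h2.2 j
    · rw [ATM.outerEst, Matrix.smul_apply, Matrix.sum_apply, smul_eq_mul, one_div_mul_eq_div]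
      congr 1
      refine Finset.sum_congr rfl fun t ht => ?_
      rw [ATM.outer, Matrix.vecMulVec_apply, hdata.score_eq (Finset.mem_Icc.1 ht).1,
        hdata.score_eq (Finset.mem_Icc.1 ht).1]
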